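/- Let $H$ be a complex Hilbert space and let $A:D(A)\subset H\to H$ be a (possibly unbounded) selfadjoint operator which is strictly positive, i.e. $\langle Au,u\rangle\ge c\|u\|^2$ on $D(A)$ for some $c>0$. Then $A$ has a spectral measure, i.e. a projection-valued measure $E_A$ on the Borel sets of $\sigma(A)\subset(0,\infty)$ with $A=\int_{\sigma(A)}s\,dE_A(s)$; for real continuous $\varphi$ on $\sigma(A)$ put $\varphi(A)=\int_{\sigma(A)}\varphi(s)\,dE_A(s)$, with domain $D(\varphi(A))=\{u\in H:\int_{\sigma(A)}|\varphi(s)|^2\,d\langle E_A(s)u,u\rangle<\infty\}$. Let $f:\sigma(A)\to[0,\infty)$ be continuous. Let $H^1=D(A^{1/2})$ with inner product $\langle A^{1/2}u,A^{1/2}v\rangle$, and let $\mathcal H=H^1\times H$ with $\|(u,v)\|_{\mathcal H}^2=\|A^{1/2}u\|^2+\|v\|^2$. Consider the linear operator $\mathbb A:D(\mathbb A)\subset\mathcal H\to\mathcal H$, $$\mathbb A(u,v)=(v,\,-(Au+f(A)v)),\qquad D(\mathbb A)=\{(u,v)\in\mathcal H:\ v\in H^1,\ Au+f(A)v\in H\},$$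 where $Au$ and $f(A)v$ are understood by duality as the functionals $w\mapsto\langle Aw,u\rangle$ and $w\mapsto\langle f(A)w,v\rangle$; that is, $Au+f(A)v=h\in H$ means $\langle Aw,u\rangle+\langle f(A)w,v\rangle=\langle w,h\rangle$ for all $w\in D(A)\cap D(f(A))$. Then $\mathbb A$ is the infinitesimal generator of a strongly continuous semigroup of contractions $S(t)=e^{t\mathbb A}$, $t\ge 0$, on $\mathcal H$. -/

import Mathlib

open MeasureTheory Filter Topology
open scoped NNReal

noncomputable section

/-! ### Spectral measures -/

/-- A spectral measure on `Ω` with values in the selfadjoint projections of `H`. Values on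
non-measurable sets are normalised to `0`, so that the map is determined by its restriction to the
`σ`-algebra. -/
structure SpectralMeasure (Ω : Type*) [MeasurableSpace Ω] (H : Type*) [NormedAddCommGroup H]
    [InnerProductSpace ℂ H] [CompleteSpace H] where
  toFun : Set Ω → (H →L[ℂ] H)
  not_measurable : ∀ ω, ¬ MeasurableSet ω → toFun ω = 0
  isStarProjection : ∀ ω, MeasurableSet ω → IsStarProjection (toFun ω)
  empty : toFun ∅ = 0
  univ : toFun Set.univ = 1
  inter : ∀ ω₁ ω₂, MeasurableSet ω₁ → MeasurableSet ω₂ →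
    toFun (ω₁ ∩ ω₂) = toFun ω₁ * toFun ω₂
  union : ∀ ω₁ ω₂, MeasurableSet ω₁ → MeasurableSet ω₂ → Disjoint ω₁ ω₂ →
    toFun (ω₁ ∪ ω₂) = toFun ω₁ + toFun ω₂
  hasSum_inner : ∀ (u v : H) (ω : ℕ → Set Ω), (∀ n, MeasurableSet (ω n)) →
    Pairwise (Function.onFun Disjoint ω) →
    HasSum (fun n => inner ℂ v (toFun (ω n) u)) (inner ℂ v (toFun (⋃ n, ω n) u))

namespace SpectralMeasure

variable {Ω : Type*} [MeasurableSpace Ω] {H : Type*} [NormedAddCommGroup H]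
  [InnerProductSpace ℂ H] [CompleteSpace H] (E : SpectralMeasure Ω H)

/-- The complex measure `μ_{u,v}(ω) = ⟨E(ω)u, v⟩` (the inner product being linear in its first
argument on paper, and in its second argument in Mathlib). -/
def complexMeasure (u v : H) : ComplexMeasure Ω where
  measureOf' ω := inner ℂ v (E.toFun ω u)
  empty' := by simp [E.empty]
  not_measurable' ω h := by simp [E.not_measurable ω h]
  m_iUnion' ω h₁ h₂ := E.hasSum_inner u v ω h₁ h₂

theorem complexMeasure_apply (u v : H) (ω : Set Ω) :
    E.complexMeasure u v ω = inner ℂ v (E.toFun ω u) := rfl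

theorem complexMeasure_add_left (u₁ u₂ v : H) :
    E.complexMeasure (u₁ + u₂) v = E.complexMeasure u₁ v + E.complexMeasure u₂ v := by
  ext ω _
  simp [complexMeasure_apply]

theorem complexMeasure_smul_left (c : ℂ) (u v : H) :
    E.complexMeasure (c • u) v = E.complexMeasure u (star c • v) := by
  ext ω _
  simp [complexMeasure_apply, mul_comm]

theorem complexMeasure_zero_left (v : H) : E.complexMeasure 0 v = 0 := by
  ext ω _
  simp [complexMeasure_apply]

theorem complexMeasure_self {ω : Set Ω} (u : H) :
    E.complexMeasure u u ω = ((‖E.toFun ω u‖ ^ 2 : ℝ) : ℂ) := by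
  by_cases hω : MeasurableSet ω
  · have h := E.isStarProjection ω hω
    have h1 : E.toFun ω u = E.toFun ω (E.toFun ω u) := by
      conv_lhs => rw [← h.isIdempotentElem.eq]
      rfl
    have h2 : ∀ x y, inner ℂ x (E.toFun ω y) = inner ℂ (E.toFun ω x) y := by
      intro x y
      have h3 : ContinuousLinearMap.adjoint (E.toFun ω) = E.toFun ω := h.isSelfAdjoint
      conv_lhs => rw [← h3]
      exact ContinuousLinearMap.adjoint_inner_right _ _ _
    rw [complexMeasure_apply, h1, h2, inner_self_eq_norm_sq_to_K, ← h1]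
    simp
  · simp [complexMeasure_apply, E.not_measurable ω hω]

theorem variation_self_add_le (u v : H) :
    (E.complexMeasure (u + v) (u + v)).variation ≤
      (2 : ℝ≥0) • ((E.complexMeasure u u).variation + (E.complexMeasure v v).variation) := by
  refine VectorMeasure.variation_le_of_forall_enorm_le fun ω _ => ?_
  have h : ‖E.complexMeasure (u + v) (u + v) ω‖₊ ≤
      2 * (‖E.complexMeasure u u ω‖₊ + ‖E.complexMeasure v v ω‖₊) := by
    rw [← NNReal.coe_le_coe]
    simp only [complexMeasure_self, NNReal.coe_mul, NNReal.coe_add, coe_nnnorm, NNReal.coe_ofNat,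
      Complex.norm_real, Real.norm_eq_abs, abs_pow, abs_norm, map_add]
    have h1 := norm_add_le (E.toFun ω u) (E.toFun ω v)
    have h2 := pow_le_pow_left₀ (norm_nonneg _) h1 2
    nlinarith [sq_nonneg (‖E.toFun ω u‖ - ‖E.toFun ω v‖)]
  calc ‖E.complexMeasure (u + v) (u + v) ω‖ₑ
      ≤ (2 : ℝ≥0) * (‖E.complexMeasure u u ω‖ₑ + ‖E.complexMeasure v v ω‖ₑ) := by
        simp only [enorm_eq_nnnorm]
        exact_mod_cast h
    _ ≤ _ := by
        rw [Measure.smul_apply, Measure.nnreal_smul_coe_apply, Measure.add_apply]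
        gcongr <;> exact VectorMeasure.enorm_measure_le_variation _ _

theorem integrable_self_smul {φ : Ω → ℝ} (c : ℂ) (u : H)
    (h : (E.complexMeasure u u).Integrable φ) :
    (E.complexMeasure (c • u) (c • u)).Integrable φ := by
  have h1 : E.complexMeasure (c • u) (c • u) = ((‖c‖ ^ 2 : ℝ)) • E.complexMeasure u u := by
    ext ω _
    rw [smul_apply, complexMeasure_self, complexMeasure_self]
    simp [norm_smul, mul_pow]
  rw [h1]
  exact h.smul_vectorMeasure _

/-- The graph of the operator `∫ φ dE`: the pairs `(u, w)` such that `∫ |φ|² dμ_{u,u} < ∞` and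
`⟨w, v⟩ = ∫ φ dμ_{u,v}` for all `v`. For measurable `φ` with `∫ |φ|² dμ_{u,u} < ∞`, exactly one
such `w` exists (the functional is bounded by `‖φ‖_{L²(μ_{u,u})} ‖v‖`), so the domain is
`{u : ∫ |φ|² dμ_{u,u} < ∞}`. -/
def integralGraph (φ : Ω → ℝ) : Submodule ℂ (H × H) where
  carrier := {p | (E.complexMeasure p.1 p.1).Integrable (fun s => φ s ^ 2) ∧
    ∀ v : H, (E.complexMeasure p.1 v).Integrable φ ∧
      inner ℂ v p.2 = (E.complexMeasure p.1 v).integral φ (ContinuousLinearMap.lsmul ℝ ℝ)}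
  add_mem' := by
    rintro ⟨u₁, w₁⟩ ⟨u₂, w₂⟩ ⟨h₁, k₁⟩ ⟨h₂, k₂⟩
    refine ⟨?_, fun v => ?_⟩
    · exact Integrable.mono_measure
        (Integrable.smul_measure_nnreal (integrable_add_measure.2 ⟨h₁, h₂⟩))
        (E.variation_self_add_le u₁ u₂)
    · simp only [Prod.fst_add, Prod.snd_add, complexMeasure_add_left]
      refine ⟨(k₁ v).1.add_vectorMeasure (k₂ v).1, ?_⟩
      rw [VectorMeasure.integral_add_vectorMeasure (k₁ v).1 (k₂ v).1, inner_add_right,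
        ← (k₁ v).2, ← (k₂ v).2]
  zero_mem' := by
    simp [complexMeasure_zero_left]
  smul_mem' := by
    rintro c ⟨u, w⟩ ⟨h, k⟩
    refine ⟨E.integrable_self_smul c u h, fun v => ?_⟩
    simp only [Prod.smul_fst, Prod.smul_snd, complexMeasure_smul_left]
    refine ⟨(k _).1, ?_⟩
    rw [← (k _).2, inner_smul_right, inner_smul_left]
    simp

theorem integralGraph_single_valued (φ : Ω → ℝ) (p : H × H) (hp : p ∈ E.integralGraph φ)
    (h : p.1 = 0) : p.2 = 0 := by
  have h1 := (hp.2 p.2).2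
  rw [h, complexMeasure_zero_left, VectorMeasure.integral_zero_vectorMeasure] at h1
  exact inner_self_eq_zero.1 h1

/-- The (unbounded) operator `∫ φ dE` for a real-valued `φ`. -/
def integral (φ : Ω → ℝ) : H →ₗ.[ℂ] H := (E.integralGraph φ).toLinearPMap

theorem graph_integral (φ : Ω → ℝ) : (E.integral φ).graph = E.integralGraph φ :=
  Submodule.toLinearPMap_graph_eq _ (E.integralGraph_single_valued φ)

theorem variation_self_apply (u : H) {ω : Set Ω} (hω : MeasurableSet ω) :
    (E.complexMeasure u u).variation ω = ENNReal.ofReal (‖E.toFun ω u‖ ^ 2) := by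
  have h0 : ∀ ω, ‖E.complexMeasure u u ω‖ₑ = ENNReal.ofReal (‖E.toFun ω u‖ ^ 2) := by
    intro ω
    rw [complexMeasure_self, ← ofReal_norm]
    simp
  apply le_antisymm
  · let m : Measure Ω := Measure.ofMeasurable
      (fun ω _ => ENNReal.ofReal (‖E.toFun ω u‖ ^ 2)) (by simp [E.empty]) (by
        intro g hg hd
        have h1 := E.hasSum_inner u u g hg hd
        simp only [← complexMeasure_apply, complexMeasure_self] at h1
        have h2 : HasSum (fun n => ‖E.toFun (g n) u‖ ^ 2) (‖E.toFun (⋃ n, g n) u‖ ^ 2) :=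
          Complex.hasSum_ofReal.1 h1
        rw [← h2.tsum_eq, ENNReal.ofReal_tsum_of_nonneg (fun _ => by positivity) h2.summable])
    have hm : ∀ ω, MeasurableSet ω → m ω = ENNReal.ofReal (‖E.toFun ω u‖ ^ 2) :=
      fun ω hω => Measure.ofMeasurable_apply ω hω
    rw [← hm ω hω]
    exact VectorMeasure.variation_le_of_forall_enorm_le
      (fun s hs => by rw [hm s hs, h0]) ω
  · rw [← h0]
    exact VectorMeasure.enorm_measure_le_variation _ _

instance isFiniteMeasure_variation_self (u : H) :
    IsFiniteMeasure (E.complexMeasure u u).variation :=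
  ⟨by rw [variation_self_apply E u MeasurableSet.univ]; exact ENNReal.ofReal_lt_top⟩

theorem integral_self_eq {φ : Ω → ℝ} (u : H) (h : (E.complexMeasure u u).Integrable φ) :
    (E.complexMeasure u u).integral φ (ContinuousLinearMap.lsmul ℝ ℝ) =
      ((∫ s, φ s ∂(E.complexMeasure u u).variation : ℝ) : ℂ) := by
  revert φ
  refine Integrable.induction _ ?_ ?_ ?_ ?_
  · intro c s hs _
    rw [MeasureTheory.integral_indicator hs, MeasureTheory.setIntegral_const,
      VectorMeasure.integral_indicator hs]
    have : IsFiniteMeasure ((E.complexMeasure u u).restrict s).variation := by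
      rw [VectorMeasure.variation_restrict hs]; infer_instance
    rw [VectorMeasure.integral_const, VectorMeasure.restrict_apply _ hs MeasurableSet.univ,
      Measure.real, E.variation_self_apply u hs, Set.univ_inter, complexMeasure_self,
      ENNReal.toReal_ofReal (by positivity)]
    simp [mul_comm]
  · intro f g _ hf hg h1 h2
    have h3 := VectorMeasure.integral_add (B := ContinuousLinearMap.lsmul ℝ ℝ) hf hg
    rw [h1, h2] at h3
    rw [MeasureTheory.integral_add' hf hg, Complex.ofReal_add, ← h3]
  · refine isClosed_eq ?_ ?_
    · exact VectorMeasure.continuous_integral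
    · exact Complex.continuous_ofReal.comp MeasureTheory.continuous_integral
  · intro f g hfg _ h1
    have h3 := VectorMeasure.integral_congr_ae (B := ContinuousLinearMap.lsmul ℝ ℝ)
      (μ := E.complexMeasure u u) hfg
    rw [← MeasureTheory.integral_congr_ae hfg, ← h1, ← h3]

/-- The operator `∫ φ dE` is injective if `φ > 0`. -/
theorem integral_injective {φ : Ω → ℝ} (hφ : ∀ s, 0 < φ s) :
    Function.Injective (E.integral φ).toFun := by
  rw [← LinearMap.ker_eq_bot, LinearMap.ker_eq_bot']
  intro u hu
  have h : ((u : H), (0 : H)) ∈ E.integralGraph φ := by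
    rw [← graph_integral, LinearPMap.mem_graph_iff]
    exact ⟨u, rfl, hu⟩
  obtain ⟨h1, h2⟩ := h.2 (u : H)
  simp only [inner_zero_right] at h2
  rw [E.integral_self_eq _ h1] at h2
  have h3 : ∫ s, φ s ∂(E.complexMeasure (u : H) u).variation = 0 := by exact_mod_cast h2.symm
  rw [MeasureTheory.integral_eq_zero_iff_of_nonneg (fun s => (hφ s).le) h1] at h3
  have h4 : (E.complexMeasure (u : H) u).variation Set.univ = 0 := by
    have h5 := MeasureTheory.ae_iff.1 h3
    convert! h5
    ext s
    simp [(hφ s).ne']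
  rw [E.variation_self_apply _ MeasurableSet.univ, E.univ] at h4
  have h6 : ‖(u : H)‖ ^ 2 ≤ 0 := by simpa using h4
  have h7 : ‖(u : H)‖ = 0 := by nlinarith [norm_nonneg (u : H)]
  exact Subtype.ext (norm_eq_zero.1 h7)

end SpectralMeasure

/-! ### Strictly positive selfadjoint operators -/

/-- The resolvent set of an unbounded operator: `z - A : D(A) → H` is bijective with bounded
inverse. -/
def LinearPMap.unboundedResolventSet {H : Type*} [NormedAddCommGroup H] [InnerProductSpace ℂ H]
    (A : H →ₗ.[ℂ] H) : Set ℂ :=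
  {z | ∃ R : H →L[ℂ] H, (∀ x : H, ∃ u : A.domain, R x = u ∧ z • (u : H) - A u = x) ∧
    ∀ u : A.domain, R (z • (u : H) - A u) = u}

/-- A strictly positive selfadjoint (possibly unbounded) operator in `H`. -/
structure StrictlyPositiveOperator (H : Type*) [NormedAddCommGroup H] [InnerProductSpace ℂ H]
    [CompleteSpace H] where
  op : H →ₗ.[ℂ] H
  isSelfAdjoint : IsSelfAdjoint op
  strictlyPositive : ∃ c : ℝ, 0 < c ∧
    ∀ u : op.domain, c * ‖(u : H)‖ ^ 2 ≤ (inner ℂ (u : H) (op u)).re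

namespace StrictlyPositiveOperator

variable {H : Type*} [NormedAddCommGroup H] [InnerProductSpace ℂ H] [CompleteSpace H]

/-- The spectrum `σ(A)`, as a subset of the real line (the spectrum of a selfadjoint operator is
real). -/
def spectrum (A : StrictlyPositiveOperator H) : Set ℝ := {s | (s : ℂ) ∉ A.op.unboundedResolventSet}

theorem pos_of_mem_spectrum (A : StrictlyPositiveOperator H) {s : ℝ} (hs : s ∈ A.spectrum) :
    0 < s := by
  by_contra! hs0
  apply hs
  obtain ⟨c, hc, hA⟩ := A.strictlyPositive
  let T : A.op.domain →ₗ[ℂ] H := (s : ℂ) • A.op.domain.subtype - A.op.toFun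
  have hT : ∀ u : A.op.domain, T u = (s : ℂ) • (u : H) - A.op u := fun u => rfl
  have hb : ∀ u : A.op.domain, c * ‖(u : H)‖ ≤ ‖T u‖ := by
    intro u
    have h1 : (inner ℂ (u : H) (T u)).re ≤ - (c * ‖(u : H)‖ ^ 2) := by
      have h2 : inner ℂ (u : H) (u : H) = ((‖(u : H)‖ ^ 2 : ℝ) : ℂ) := by
        rw [inner_self_eq_norm_sq_to_K]; simp
      rw [hT, inner_sub_right, inner_smul_right, h2, ← Complex.ofReal_mul, Complex.sub_re,
        Complex.ofReal_re]
      nlinarith [hA u, sq_nonneg ‖(u : H)‖]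
    have h3 := (Complex.abs_re_le_norm _).trans (norm_inner_le_norm (𝕜 := ℂ) (u : H) (T u))
    have h4 := neg_le_abs (inner ℂ (u : H) (T u)).re
    rcases (norm_nonneg (u : H)).eq_or_lt with h0 | h0
    · rw [← h0]; simp
    · nlinarith
  have hinj : Function.Injective T := by
    rw [← LinearMap.ker_eq_bot, LinearMap.ker_eq_bot']
    intro u hu
    have h1 := hb u
    rw [hu, norm_zero] at h1
    have h2 : ‖(u : H)‖ = 0 := by nlinarith [norm_nonneg (u : H)]
    exact Subtype.ext (norm_eq_zero.1 h2)
  have hclosed : IsClosed (LinearMap.range T : Set H) := by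
    refine IsSeqClosed.isClosed fun y y₀ hy hlim => ?_
    choose u hu using hy
    have hcau : CauchySeq (fun n => (u n : H)) := by
      rw [Metric.cauchySeq_iff]
      intro ε hε
      obtain ⟨N, hN⟩ := Metric.cauchySeq_iff.1 hlim.cauchySeq (c * ε) (by positivity)
      refine ⟨N, fun m hm n hn => ?_⟩
      have h1 := hN m hm n hn
      have h2 := hb (u m - u n)
      rw [map_sub, hu, hu, ← dist_eq_norm, Submodule.coe_sub, ← dist_eq_norm] at h2
      exact lt_of_mul_lt_mul_left (h2.trans_lt h1) hc.le
    obtain ⟨u₀, hu₀⟩ := cauchySeq_tendsto_of_complete hcau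
    have hg : (u₀, (s : ℂ) • u₀ - y₀) ∈ A.op.graph := by
      refine A.isSelfAdjoint.isClosed.mem_of_tendsto
        (hu₀.prodMk_nhds ((hu₀.const_smul (s : ℂ)).sub hlim)) (Eventually.of_forall fun n => ?_)
      simp only [SetLike.mem_coe, LinearPMap.mem_graph_iff]
      refine ⟨u n, rfl, ?_⟩
      rw [← hu n, hT]
      abel
    obtain ⟨w, hw1, hw2⟩ := (LinearPMap.mem_graph_iff _).1 hg
    refine ⟨w, ?_⟩
    simp only at hw1 hw2
    rw [hT, hw1, hw2]
    abel
  have hsurj : Function.Surjective T := by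
    rw [← LinearMap.range_eq_top, ← hclosed.submodule_topologicalClosure_eq,
      Submodule.topologicalClosure_eq_top_iff, Submodule.eq_bot_iff]
    intro w hw
    have h1 : ∀ u : A.op.domain, inner ℂ ((s : ℂ) • w) (u : H) = inner ℂ w (A.op u) := by
      intro u
      have h2 := (Submodule.mem_orthogonal' _ _).1 hw (T u) ⟨u, rfl⟩
      rw [hT, inner_sub_right, inner_smul_right, sub_eq_zero] at h2
      rw [inner_smul_left, ← h2]
      simp
    have hdense := A.isSelfAdjoint.dense_domain
    have hdom : w ∈ A.op.adjoint.domain :=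
      LinearPMap.mem_adjoint_domain_of_exists _ ⟨_, h1⟩
    have happ : A.op.adjoint ⟨w, hdom⟩ = (s : ℂ) • w :=
      LinearPMap.adjoint_apply_eq hdense _ h1
    have hg : (w, (s : ℂ) • w) ∈ A.op.adjoint.graph :=
      (LinearPMap.mem_graph_iff _).2 ⟨⟨w, hdom⟩, rfl, happ⟩
    rw [LinearPMap.isSelfAdjoint_def.1 A.isSelfAdjoint] at hg
    obtain ⟨v, hv1, hv2⟩ := (LinearPMap.mem_graph_iff _).1 hg
    simp only at hv1 hv2
    have h3 := hb v
    rw [hT, hv2, hv1, sub_self, norm_zero] at h3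
    exact norm_eq_zero.1 (by nlinarith [norm_nonneg w])
  let e := LinearEquiv.ofBijective T ⟨hinj, hsurj⟩
  have he : ∀ x, T (e.symm x) = x := fun x => e.apply_symm_apply x
  let R : H →L[ℂ] H := LinearMap.mkContinuous
    (A.op.domain.subtype ∘ₗ (e.symm : H →ₗ[ℂ] A.op.domain)) c⁻¹ (by
      intro x
      have h1 := hb (e.symm x)
      rw [he] at h1
      rw [inv_mul_eq_div, le_div_iff₀' hc]
      exact h1)
  exact ⟨R, fun x => ⟨e.symm x, rfl, he x⟩, fun u => congrArg Subtype.val (e.symm_apply_apply u)⟩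

/-- `E` is the spectral measure of `A`: it is a spectral measure on the Borel sets of `σ(A)` and
`A = ∫ s dE(s)`, as unbounded operators. -/
def IsSpectralMeasure (A : StrictlyPositiveOperator H) (E : SpectralMeasure A.spectrum H) : Prop :=
  A.op = E.integral (fun s => (s : ℝ))

variable {A : StrictlyPositiveOperator H}

/-- The square root `A^{1/2} = ∫ √s dE(s)`. -/
def sqrtOp (E : SpectralMeasure A.spectrum H) : H →ₗ.[ℂ] H :=
  E.integral (fun s => √(s : ℝ))

/-- The space `H¹ = D(A^{1/2})`, with inner product `⟨A^{1/2} u, A^{1/2} v⟩`. -/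
def H1 (E : SpectralMeasure A.spectrum H) : Type _ := (sqrtOp E).domain

instance (E : SpectralMeasure A.spectrum H) : AddCommGroup (H1 E) :=
  inferInstanceAs (AddCommGroup (sqrtOp E).domain)

instance (E : SpectralMeasure A.spectrum H) : Module ℂ (H1 E) :=
  inferInstanceAs (Module ℂ (sqrtOp E).domain)

/-- The inclusion `H¹ → H`. -/
def H1.incl (E : SpectralMeasure A.spectrum H) : H1 E →ₗ[ℂ] H := (sqrtOp E).domain.subtype

/-- The map `A^{1/2} : H¹ → H`. -/
def H1.sqrt (E : SpectralMeasure A.spectrum H) : H1 E →ₗ[ℂ] H := (sqrtOp E).toFun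

theorem H1.sqrt_injective (E : SpectralMeasure A.spectrum H) : Function.Injective (H1.sqrt E) :=
  E.integral_injective fun s => Real.sqrt_pos.2 (A.pos_of_mem_spectrum s.2)

/-- The norm `‖u‖₁ = ‖A^{1/2} u‖`. -/
instance (E : SpectralMeasure A.spectrum H) : NormedAddCommGroup (H1 E) :=
  NormedAddCommGroup.induced (H1 E) H (H1.sqrt E) (H1.sqrt_injective E)

instance (E : SpectralMeasure A.spectrum H) : InnerProductSpace ℂ (H1 E) where
  norm_smul_le c u := by
    change ‖H1.sqrt E (c • u)‖ ≤ ‖c‖ * ‖H1.sqrt E u‖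
    rw [map_smul, norm_smul]
  inner u v := inner ℂ (H1.sqrt E u) (H1.sqrt E v)
  norm_sq_eq_re_inner u := norm_sq_eq_re_inner (𝕜 := ℂ) (H1.sqrt E u)
  conj_inner_symm _ _ := inner_conj_symm _ _
  add_left u v w := by rw [map_add, inner_add_left]
  smul_left u v c := by rw [map_smul, inner_smul_left]

/-- The phase space `H¹ × H` with the norm `‖(u, v)‖² = ‖u‖₁² + ‖v‖²`. -/
abbrev PhaseSpace (E : SpectralMeasure A.spectrum H) : Type _ := WithLp 2 (H1 E × H)

/-- The operator `f(A) = ∫ f(s) dE(s)`. -/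
def damping (E : SpectralMeasure A.spectrum H) (f : C(A.spectrum, ℝ≥0)) : H →ₗ.[ℂ] H :=
  E.integral (fun s => (f s : ℝ))

/-- `A u + f(A) v = h` with `h ∈ H`, where `A u` and `f(A) v` are understood by duality, as the
functionals `w ↦ ⟨A w, u⟩` and `w ↦ ⟨f(A) w, v⟩`, on the space `D(A) ∩ D(f(A))` on which both are
defined, and `h` is identified with `w ↦ ⟨w, h⟩`. -/
def DualSumEq (E : SpectralMeasure A.spectrum H) (f : C(A.spectrum, ℝ≥0)) (u v h : H) : Prop :=
  ∀ (w : H) (hw : w ∈ A.op.domain) (hw' : w ∈ (damping E f).domain),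
    inner ℂ u (A.op ⟨w, hw⟩) + inner ℂ v (damping E f ⟨w, hw'⟩) = inner ℂ h w

/-- The graph of the operator `𝔸(u, v) = (v, -(A u + f(A) v))` in `H¹ × H` with domain
`{(u, v) ∈ H¹ × H : v ∈ H¹, A u + f(A) v ∈ H}`: it consists of the pairs `((u, v), (u', v'))` with
`u' = v` (so `v ∈ H¹`) and `A u + f(A) v = -v' ∈ H`. -/
def waveGraph (E : SpectralMeasure A.spectrum H) (f : C(A.spectrum, ℝ≥0)) :
    Submodule ℂ (PhaseSpace E × PhaseSpace E) where
  carrier := {p | H1.incl E p.2.fst = p.1.snd ∧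
    DualSumEq E f (H1.incl E p.1.fst) p.1.snd (-p.2.snd)}
  add_mem' := by
    rintro p q ⟨h₁, k₁⟩ ⟨h₂, k₂⟩
    refine ⟨?_, fun w hw hw' => ?_⟩
    · simp [h₁, h₂]
    · have a := k₁ w hw hw'
      have b := k₂ w hw hw'
      simp only [Prod.fst_add, Prod.snd_add, WithLp.add_fst, WithLp.add_snd, map_add, neg_add,
        inner_add_left]
      rw [← a, ← b]
      ring
  zero_mem' := by
    refine ⟨by simp, fun w hw hw' => by simp⟩
  smul_mem' := by
    rintro c p ⟨h, k⟩
    refine ⟨?_, fun w hw hw' => ?_⟩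
    · simp [h]
    · have a := k w hw hw'
      simp only [Prod.smul_fst, Prod.smul_snd, WithLp.smul_fst, WithLp.smul_snd, map_smul,
        ← smul_neg, inner_smul_left]
      rw [← a]
      ring

end StrictlyPositiveOperator

/-! ### Semigroups -/

/-- A strongly continuous semigroup of contractions on a normed space. -/
structure ContractionSemigroup (X : Type*) [NormedAddCommGroup X] [NormedSpace ℂ X] where
  toFun : ℝ≥0 → X →L[ℂ] X
  map_zero : toFun 0 = 1
  map_add : ∀ s t, toFun (s + t) = toFun s * toFun t
  tendsto_zero : ∀ x, Tendsto (fun t => toFun t x) (𝓝[>] 0) (𝓝 x)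
  norm_le_one : ∀ t, ‖toFun t‖ ≤ 1

namespace ContractionSemigroup

variable {X : Type*} [NormedAddCommGroup X] [NormedSpace ℂ X] (S : ContractionSemigroup X)

/-- The graph of the infinitesimal generator: the pairs `(x, y)` with
`y = lim_{t → 0+} (S(t) x - x) / t`. -/
def generatorGraph : Submodule ℂ (X × X) where
  carrier := {p | Tendsto (fun t : ℝ≥0 => ((t : ℝ) : ℂ)⁻¹ • (S.toFun t p.1 - p.1)) (𝓝[>] 0)
    (𝓝 p.2)}
  add_mem' := by
    intro p q hp hq
    refine (hp.add hq).congr fun t => ?_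
    simp only [Prod.fst_add, _root_.map_add, ← smul_add]
    congr 1
    abel
  zero_mem' := by
    simp
  smul_mem' := by
    intro c p hp
    refine (hp.const_smul c).congr fun t => ?_
    simp only [Prod.smul_fst, map_smul, ← smul_sub]
    rw [smul_comm]

/-- The infinitesimal generator, with its natural domain. -/
def generator : X →ₗ.[ℂ] X := S.generatorGraph.toLinearPMap

theorem graph_generator : S.generator.graph = S.generatorGraph := by
  refine Submodule.toLinearPMap_graph_eq _ fun p hp h => ?_
  change Tendsto _ _ _ at hp
  simp only [h, _root_.map_zero, sub_zero, smul_zero] at hp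
  exact tendsto_nhds_unique hp tendsto_const_nhds

end ContractionSemigroup

end

/-! The generator is built by truncation rather than from a range condition. The sets `cutoff f n`,
on which `s` and `f s` are at most `n`, exhaust the spectrum. Cutting the wave operator down to them
gives bounded operators `G n`. The map `A^{1/2} : H¹ → H` is a surjective isometry because the
spectrum stays away from `0`. In this picture the off-diagonal entries of `G n` cancel in the real
part, leaving `-⟨F v, v⟩ ≤ 0` with `F` the truncation of `f(A)`. Hence each `e^{t G n}` is a
contraction. For `n ≥ m` they agree on the range of the projection `P m`, and `P m → 1` strongly, so
they converge strongly to a contraction semigroup.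

The generator of the limit has graph `{(x, y) : G n x = P n y for all n}`
(`TruncatedGenerator.mem_generatorGraph_iff`). The graph of `∫ φ dE` has the same shape
(`IsCutoff.mem_integralGraph_iff`), so the two can be compared componentwise. The first component
says that the velocity lies in `H¹`; the second is the duality equation, tested on the vectors `E(ω
n) x`, which lie in both domains (`dualSumEq_iff`).

A spectral measure exists because `T = A⁻¹` is bounded and selfadjoint. Continuous functional
calculus and Riesz–Markov give measures `μ_u` with `⟨φ(T)u, u⟩ = ∫ φ dμ_u`. The map `φ ↦ φ(T)u`
extends to an isometry of `L²(μ_u)` into `H`, and the images of indicators define the projections.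
Injectivity of `T` excludes mass at `0`, so everything transports along `s ↦ s⁻¹` to the spectrum of
`A`. -/

/-! ### The bounded functional calculus of a spectral measure -/

/-- Measurable bounded real functions. -/
structure IsBoundedMeasurable {Ω : Type*} [MeasurableSpace Ω] (g : Ω → ℝ) : Prop where
  measurable : Measurable g
  bounded : ∃ C : ℝ, ∀ x, ‖g x‖ ≤ C

namespace IsBoundedMeasurable

variable {Ω : Type*} [MeasurableSpace Ω] {g h : Ω → ℝ}

theorem mul (hg : IsBoundedMeasurable g) (hh : IsBoundedMeasurable h) :
    IsBoundedMeasurable (fun x => g x * h x) := by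
  obtain ⟨C, hC⟩ := hg.bounded
  obtain ⟨D, hD⟩ := hh.bounded
  refine ⟨hg.measurable.mul hh.measurable, C * D, fun x => ?_⟩
  rw [norm_mul]
  exact mul_le_mul (hC x) (hD x) (norm_nonneg _) ((norm_nonneg _).trans (hC x))

theorem add (hg : IsBoundedMeasurable g) (hh : IsBoundedMeasurable h) :
    IsBoundedMeasurable (g + h) := by
  obtain ⟨C, hC⟩ := hg.bounded
  obtain ⟨D, hD⟩ := hh.bounded
  exact ⟨hg.measurable.add hh.measurable, C + D,
    fun x => (norm_add_le _ _).trans (add_le_add (hC x) (hD x))⟩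

theorem indicator_const (c : ℝ) {s : Set Ω} (hs : MeasurableSet s) :
    IsBoundedMeasurable (s.indicator fun _ => c) :=
  ⟨measurable_const.indicator hs, ‖c‖, fun x => norm_indicator_le_norm_self (fun _ => c) x⟩

theorem indicator_of_bound {φ : Ω → ℝ} (hφ : Measurable φ) {s : Set Ω} (hs : MeasurableSet s)
    {C : ℝ} (hC : ∀ x ∈ s, ‖φ x‖ ≤ C) : IsBoundedMeasurable (s.indicator φ) := by
  refine ⟨hφ.indicator hs, |C|, fun x => ?_⟩
  by_cases hx : x ∈ s
  · rw [Set.indicator_of_mem hx]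
    exact (hC x hx).trans (le_abs_self C)
  · rw [Set.indicator_of_notMem hx, norm_zero]
    exact abs_nonneg C

theorem integrable (hg : IsBoundedMeasurable g) (μ : Measure Ω) [IsFiniteMeasure μ] :
    Integrable g μ := by
  obtain ⟨C, hC⟩ := hg.bounded
  exact Integrable.of_bound hg.measurable.aestronglyMeasurable C (ae_of_all _ hC)

/-- A property of bounded measurable functions holds if it holds for multiples of indicators, and
is stable under sums and under bounded pointwise limits. -/
theorem induction {P : (Ω → ℝ) → Prop}
    (h_ind : ∀ (c : ℝ) (s : Set Ω), MeasurableSet s → P (s.indicator fun _ => c))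
    (h_add : ∀ f g, IsBoundedMeasurable f → IsBoundedMeasurable g → P f → P g → P (f + g))
    (h_lim : ∀ (F : ℕ → Ω → ℝ) (f : Ω → ℝ) (C : ℝ), (∀ n, Measurable (F n)) →
      (∀ n x, ‖F n x‖ ≤ C) → (∀ x, Tendsto (fun n => F n x) atTop (𝓝 (f x))) →
      (∀ n, P (F n)) → P f)
    (hg : IsBoundedMeasurable g) : P g := by
  classical
  have hs : ∀ φ : SimpleFunc Ω ℝ, IsBoundedMeasurable φ ∧ P φ := by
    intro φ
    induction φ using SimpleFunc.induction with
    | const c hs =>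
      rw [SimpleFunc.coe_piecewise, SimpleFunc.coe_const, SimpleFunc.coe_const,
        Function.const_zero, Set.piecewise_eq_indicator]
      exact ⟨indicator_const c hs, h_ind c _ hs⟩
    | add _ h1 h2 =>
      rw [SimpleFunc.coe_add]
      exact ⟨h1.1.add h2.1, h_add _ _ h1.1 h2.1 h1.2 h2.2⟩
  obtain ⟨C, hC⟩ := hg.bounded
  have hm := hg.measurable.stronglyMeasurable
  -- The absolute value is needed because `C` may be negative when `Ω` is empty.
  refine h_lim (fun n => hm.approxBounded |C| n) g |C| (fun n => SimpleFunc.measurable _)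
    (fun n x => hm.norm_approxBounded_le (abs_nonneg C) n x) (fun x => ?_) fun n => (hs _).2
  exact hm.tendsto_approxBounded_of_norm_le ((hC x).trans (le_abs_self C))

end IsBoundedMeasurable

/-! ### Sesquilinear forms `∫ g dμ_{u,v}` and the operators representing them. -/

namespace SpectralMeasure

variable {Ω : Type*} [MeasurableSpace Ω] {H : Type*} [NormedAddCommGroup H]
  [InnerProductSpace ℂ H] [CompleteSpace H] (E : SpectralMeasure Ω H)

theorem inner_toFun_right (ω : Set Ω) (x y : H) :
    inner ℂ x (E.toFun ω y) = inner ℂ (E.toFun ω x) y := by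
  by_cases hω : MeasurableSet ω
  · have h3 : ContinuousLinearMap.adjoint (E.toFun ω) = E.toFun ω :=
      (E.isStarProjection ω hω).isSelfAdjoint
    conv_lhs => rw [← h3]
    exact ContinuousLinearMap.adjoint_inner_right _ _ _
  · simp [E.not_measurable ω hω]

theorem toFun_toFun {ω₁ ω₂ : Set Ω} (h₁ : MeasurableSet ω₁) (h₂ : MeasurableSet ω₂) (u : H) :
    E.toFun ω₁ (E.toFun ω₂ u) = E.toFun (ω₁ ∩ ω₂) u := by
  rw [E.inter _ _ h₁ h₂]
  rfl

theorem inner_toFun_eq (ω : Set Ω) (x y : H) :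
    inner ℂ x (E.toFun ω y) = inner ℂ (E.toFun ω x) (E.toFun ω y) := by
  by_cases hω : MeasurableSet ω
  · rw [← inner_toFun_right, toFun_toFun E hω hω, Set.inter_self]
  · simp [E.not_measurable ω hω]

theorem norm_toFun_le (ω : Set Ω) (x : H) : ‖E.toFun ω x‖ ≤ ‖x‖ := by
  have h : ‖E.toFun ω x‖ ^ 2 ≤ ‖x‖ * ‖E.toFun ω x‖ := by
    have h1 := norm_inner_le_norm (𝕜 := ℂ) x (E.toFun ω x)
    rw [inner_toFun_eq, inner_self_eq_norm_sq_to_K] at h1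
    simpa using h1
  rcases (norm_nonneg (E.toFun ω x)).eq_or_lt with h0 | h0
  · rw [← h0]; exact norm_nonneg x
  · nlinarith

theorem complexMeasure_smul (c : ℂ) (u v : H) :
    E.complexMeasure (c • u) v = c • E.complexMeasure u v := by
  ext ω _
  simp [complexMeasure_apply]

/-- On each set, `|⟨E(ω)u, v⟩| = |⟨E(ω)u, E(ω)v⟩| ≤ ‖E(ω)u‖² + ‖E(ω)v‖²`, and the right side is
additive in `ω`. In particular every `μ_{u,v}` has finite variation. -/
theorem variation_le (u v : H) : (E.complexMeasure u v).variation ≤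
    (E.complexMeasure u u).variation + (E.complexMeasure v v).variation := by
  refine VectorMeasure.variation_le_of_forall_enorm_le fun ω hω => ?_
  rw [Measure.add_apply, variation_self_apply E u hω, variation_self_apply E v hω,
    ← ENNReal.ofReal_add (by positivity) (by positivity), ← ofReal_norm]
  refine ENNReal.ofReal_le_ofReal ?_
  rw [complexMeasure_apply, inner_toFun_eq]
  refine (norm_inner_le_norm _ _).trans ?_
  nlinarith [sq_nonneg (‖E.toFun ω u‖ - ‖E.toFun ω v‖), norm_nonneg (E.toFun ω u),
    norm_nonneg (E.toFun ω v), mul_nonneg (norm_nonneg (E.toFun ω u)) (norm_nonneg (E.toFun ω v))]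

instance isFiniteMeasure_variation (u v : H) :
    IsFiniteMeasure (E.complexMeasure u v).variation :=
  isFiniteMeasure_of_le _ (E.variation_le u v)

/-- Rescaling `u` by `c` in `variation_le` yields a Young inequality with a free weight, which may
be chosen differently on each set. -/
theorem mul_variation_le (c : ℝ≥0) (u v : H) (ω : Set Ω) :
    c * (E.complexMeasure u v).variation ω ≤
      c ^ 2 * (E.complexMeasure u u).variation ω + (E.complexMeasure v v).variation ω := by
  have h1 := E.variation_le (((c : ℝ) : ℂ) • u) v ω
  have h2 : E.complexMeasure (((c : ℝ) : ℂ) • u) (((c : ℝ) : ℂ) • u) =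
      ((c ^ 2 : ℝ) : ℂ) • E.complexMeasure u u := by
    ext ω _
    rw [complexMeasure_self, smul_apply, complexMeasure_self]
    simp [norm_smul, mul_pow]
  rw [Measure.add_apply, h2, complexMeasure_smul, VectorMeasure.variation_smul,
    VectorMeasure.variation_smul, Measure.smul_apply, Measure.smul_apply] at h1
  simpa [ENNReal.smul_def] using h1

/-- The functional `∫ φ dμ_{u,v}`, where `μ_{u,v} = ⟨E(·)u, v⟩`. -/
noncomputable abbrev form (φ : Ω → ℝ) (u v : H) : ℂ :=
  (E.complexMeasure u v).integral φ (ContinuousLinearMap.lsmul ℝ ℝ)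

variable {E} {g h : Ω → ℝ}

theorem form_indicator_const (c : ℝ) {s : Set Ω} (hs : MeasurableSet s) (u v : H) :
    E.form (s.indicator fun _ => c) u v = c * inner ℂ v (E.toFun s u) := by
  have : IsFiniteMeasure ((E.complexMeasure u v).restrict s).variation := by
    rw [VectorMeasure.variation_restrict hs]; infer_instance
  rw [form, VectorMeasure.integral_indicator hs,
    VectorMeasure.integral_const, VectorMeasure.restrict_apply _ hs MeasurableSet.univ,
    Set.univ_inter, complexMeasure_apply]
  simp

theorem form_add (hg : IsBoundedMeasurable g) (hh : IsBoundedMeasurable h) (u v : H) :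
    E.form (g + h) u v = E.form g u v + E.form h u v :=
  VectorMeasure.integral_add (hg.integrable _) (hh.integrable _)

theorem tendsto_form {F : ℕ → Ω → ℝ} {f : Ω → ℝ} {C : ℝ} (hF : ∀ n, Measurable (F n))
    (hC : ∀ n x, ‖F n x‖ ≤ C) (hf : ∀ x, Tendsto (fun n => F n x) atTop (𝓝 (f x))) (u v : H) :
    Tendsto (fun n => E.form (F n) u v) atTop (𝓝 (E.form f u v)) :=
  VectorMeasure.tendsto_integral_of_dominated_convergence (fun _ => C)
    (fun n => (hF n).aestronglyMeasurable) (integrable_const C)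
    (fun n => ae_of_all _ (hC n)) (ae_of_all _ hf)

theorem form_add_left (hg : IsBoundedMeasurable g) (u₁ u₂ v : H) :
    E.form g (u₁ + u₂) v = E.form g u₁ v + E.form g u₂ v := by
  rw [form, complexMeasure_add_left]
  exact VectorMeasure.integral_add_vectorMeasure (hg.integrable _) (hg.integrable _)

theorem form_smul_left (hg : IsBoundedMeasurable g) (c : ℂ) (u v : H) :
    E.form g (c • u) v = c * E.form g u v := by
  refine hg.induction (P := fun g => E.form g (c • u) v = c * E.form g u v) ?_ ?_ ?_
  · intro r s hs
    rw [form_indicator_const r hs, form_indicator_const r hs, map_smul, inner_smul_right]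
    ring
  · intro f g hf hg h1 h2
    rw [form_add hf hg, form_add hf hg, h1, h2, mul_add]
  · intro F f C hF hC hf hP
    refine tendsto_nhds_unique (tendsto_form hF hC hf _ _) ?_
    simp_rw [hP]
    exact (tendsto_form hF hC hf _ _).const_mul c

theorem form_conj (hg : IsBoundedMeasurable g) (u v : H) :
    E.form g v u = star (E.form g u v) := by
  refine hg.induction (P := fun g => E.form g v u = star (E.form g u v)) ?_ ?_ ?_
  · intro r s hs
    rw [form_indicator_const r hs, form_indicator_const r hs, inner_toFun_right,
      ← inner_conj_symm]
    simp
  · intro f g hf hg h1 h2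
    rw [form_add hf hg, form_add hf hg, h1, h2, star_add]
  · intro F f C hF hC hf hP
    refine tendsto_nhds_unique (tendsto_form hF hC hf _ _) ?_
    simp_rw [hP]
    exact (continuous_star.tendsto _).comp (tendsto_form hF hC hf _ _)

theorem norm_form_le {C : ℝ} (hC0 : 0 ≤ C) (hC : ∀ x, ‖g x‖ ≤ C) (u v : H) :
    ‖E.form g u v‖ ≤ C * (‖u‖ ^ 2 + ‖v‖ ^ 2) := by
  have h1 := VectorMeasure.norm_integral_le_of_norm_le_const (μ := E.complexMeasure u v)
    (B := (ContinuousLinearMap.lsmul ℝ ℝ : ℝ →L[ℝ] ℂ →L[ℝ] ℂ)) (f := g) (ae_of_all _ hC)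
  have h2 : (E.complexMeasure u v).variation.real Set.univ ≤ ‖u‖ ^ 2 + ‖v‖ ^ 2 := by
    rw [Measure.real]
    refine ENNReal.toReal_le_of_le_ofReal (by positivity) ((E.variation_le u v _).trans ?_)
    rw [Measure.add_apply, variation_self_apply E u .univ, variation_self_apply E v .univ, E.univ,
      ← ENNReal.ofReal_add (by positivity) (by positivity)]
    simp
  have h3 : ‖(ContinuousLinearMap.lsmul ℝ ℝ : ℝ →L[ℝ] ℂ →L[ℝ] ℂ)‖ ≤ 1 :=
    ContinuousLinearMap.opNorm_lsmul_le
  calc _ ≤ _ := h1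
    _ ≤ C * 1 * (‖u‖ ^ 2 + ‖v‖ ^ 2) := by gcongr
    _ = _ := by ring

/-- Rescaling `u` to the norm of `v` turns the additive bound `‖u‖² + ‖v‖²` into a product, which is
where the factor `2` arises. This is the boundedness required by Riesz representation. -/
theorem norm_form_le_mul (hg : IsBoundedMeasurable g) {C : ℝ} (hC0 : 0 ≤ C)
    (hC : ∀ x, ‖g x‖ ≤ C) (u v : H) : ‖E.form g u v‖ ≤ 2 * C * ‖u‖ * ‖v‖ := by
  rcases eq_or_ne u 0 with rfl | hu
  · have := form_smul_left (E := E) hg 0 0 v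
    rw [smul_zero, zero_mul] at this
    simp [this]
  rcases eq_or_ne v 0 with rfl | hv
  · have := form_smul_left (E := E) hg 0 0 u
    rw [smul_zero, zero_mul] at this
    rw [form_conj hg, this]
    simp
  have hu' := norm_pos_iff.2 hu
  have hv' := norm_pos_iff.2 hv
  have h1 := norm_form_le (E := E) hC0 hC (((‖v‖ / ‖u‖ : ℝ) : ℂ) • u) v
  rw [form_smul_left hg, norm_mul, norm_smul, Complex.norm_real,
    Real.norm_of_nonneg (by positivity), div_mul_cancel₀ _ hu'.ne', div_mul_eq_mul_div, div_le_iff₀ hu'] at h1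
  refine le_of_mul_le_mul_left ?_ hv'
  calc _ ≤ _ := h1
    _ = _ := by ring

theorem exists_operator (E : SpectralMeasure Ω H) (hg : IsBoundedMeasurable g) :
    ∃ T : H →L[ℂ] H, ∀ u v, inner ℂ v (T u) = E.form g u v := by
  obtain ⟨C, hC⟩ := hg.bounded
  let B : H →L⋆[ℂ] H →L[ℂ] ℂ := LinearMap.mkContinuous₂
    (LinearMap.mk₂'ₛₗ (starRingEnd ℂ) (RingHom.id ℂ) (fun v w => E.form g w v)
      (fun v₁ v₂ w => by
        rw [form_conj hg, form_add_left hg, star_add, ← form_conj hg, ← form_conj hg])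
      (fun c v w => by
        rw [form_conj hg, form_smul_left hg, star_mul', ← form_conj hg]; rfl)
      (fun v w₁ w₂ => form_add_left hg _ _ _)
      (fun c v w => form_smul_left hg _ _ _)) (2 * |C|) (fun v w => by
        have := norm_form_le_mul (E := E) hg (abs_nonneg C)
          (fun x => (hC x).trans (le_abs_self C)) w v
        refine this.trans (le_of_eq ?_)
        ring)
  -- Riesz represents `B v u` as `⟨B♯ v, u⟩`; the adjoint moves the operator to the second slot.
  refine ⟨ContinuousLinearMap.adjoint (InnerProductSpace.continuousLinearMapOfBilin B),
    fun u v => ?_⟩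
  rw [ContinuousLinearMap.adjoint_inner_right, InnerProductSpace.continuousLinearMapOfBilin_apply]
  rfl

open Classical in
/-- The bounded operator `∫ g dE` for bounded measurable `g`. -/
noncomputable def bounded (E : SpectralMeasure Ω H) (g : Ω → ℝ) : H →L[ℂ] H :=
  if hg : IsBoundedMeasurable g then (E.exists_operator hg).choose else 0

theorem inner_bounded (hg : IsBoundedMeasurable g) (u v : H) :
    inner ℂ v (E.bounded g u) = E.form g u v := by
  rw [bounded, dif_pos hg]
  exact (E.exists_operator hg).choose_spec u v

theorem inner_bounded_left (hg : IsBoundedMeasurable g) (u v : H) :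
    inner ℂ (E.bounded g v) u = inner ℂ v (E.bounded g u) := by
  rw [inner_bounded hg, ← inner_conj_symm, inner_bounded hg, form_conj hg]
  exact star_star _

theorem bounded_indicator_one {s : Set Ω} (hs : MeasurableSet s) :
    E.bounded (s.indicator fun _ => 1) = E.toFun s := by
  ext u
  refine ext_inner_left ℂ fun v => ?_
  rw [inner_bounded (.indicator_const 1 hs), form_indicator_const 1 hs]
  simp

/-- Projecting `v` restricts the measure, since `⟨E(t)u, E(s)v⟩ = ⟨E(s ∩ t)u, v⟩`. No condition on
`φ` is imposed, so this also serves unbounded integrands. -/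
theorem form_toFun_right {s : Set Ω} (hs : MeasurableSet s) (φ : Ω → ℝ) (u v : H) :
    E.form φ u (E.toFun s v) = E.form (s.indicator φ) u v := by
  have h1 : E.complexMeasure u (E.toFun s v) = (E.complexMeasure u v).restrict s := by
    ext t ht
    rw [VectorMeasure.restrict_apply _ hs ht, complexMeasure_apply, complexMeasure_apply,
      ← inner_toFun_right, E.toFun_toFun hs ht, Set.inter_comm]
  rw [form, form, h1, VectorMeasure.integral_indicator hs]

/-- Multiplicativity of the calculus in weak form. For an indicator the projection passes to `v`,
where it cuts off the measure of `h`; sums and bounded pointwise limits give the rest. -/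
theorem form_bounded_left (hg : IsBoundedMeasurable g) (hh : IsBoundedMeasurable h) (u v : H) :
    E.form g (E.bounded h u) v = E.form (fun x => g x * h x) u v := by
  refine hg.induction
    (P := fun g => E.form g (E.bounded h u) v = E.form (fun x => g x * h x) u v) ?_ ?_ ?_
  · intro r s hs
    rw [form_indicator_const r hs, inner_toFun_right, inner_bounded hh, form_toFun_right hs]
    have h1 : (fun x => s.indicator (fun _ => r) x * h x) = r • s.indicator h := by
      ext x
      by_cases hx : x ∈ s <;> simp [hx]
    rw [h1, form, form, VectorMeasure.integral_smul]
    simp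
  · intro f g hf hg h1 h2
    rw [form_add hf hg, h1, h2, ← form_add (hf.mul hh) (hg.mul hh)]
    congr 1
    ext x
    simp [add_mul]
  · intro F f C hF hC hf hP
    obtain ⟨D, hD⟩ := hh.bounded
    refine tendsto_nhds_unique (tendsto_form hF hC hf _ _) ?_
    simp_rw [hP]
    refine tendsto_form (F := fun n x => F n x * h x) (C := C * D)
      (fun n => (hF n).mul hh.measurable) (fun n x => ?_) (fun x => (hf x).mul_const _) _ _
    rw [norm_mul]
    exact mul_le_mul (hC n x) (hD x) (norm_nonneg _) ((norm_nonneg _).trans (hC n x))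

theorem bounded_bounded (hg : IsBoundedMeasurable g) (hh : IsBoundedMeasurable h) (u : H) :
    E.bounded g (E.bounded h u) = E.bounded (fun x => g x * h x) u := by
  refine ext_inner_left ℂ fun v => ?_
  rw [inner_bounded hg, inner_bounded (hg.mul hh), form_bounded_left hg hh]

theorem toFun_bounded {s : Set Ω} (hs : MeasurableSet s) (hg : IsBoundedMeasurable g) (u : H) :
    E.toFun s (E.bounded g u) = E.bounded (s.indicator g) u := by
  rw [← bounded_indicator_one hs, bounded_bounded (.indicator_const 1 hs) hg]
  congr 2
  ext x
  by_cases hx : x ∈ s <;> simp [hx]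

theorem bounded_toFun {s : Set Ω} (hs : MeasurableSet s) (hg : IsBoundedMeasurable g) (u : H) :
    E.bounded g (E.toFun s u) = E.bounded (s.indicator g) u := by
  rw [← bounded_indicator_one hs, bounded_bounded hg (.indicator_const 1 hs)]
  congr 2
  ext x
  by_cases hx : x ∈ s <;> simp [hx]

theorem inner_bounded_self (hg : IsBoundedMeasurable g) (u : H) :
    inner ℂ u (E.bounded g u) = ((∫ s, g s ∂(E.complexMeasure u u).variation : ℝ) : ℂ) := by
  rw [inner_bounded hg]
  exact E.integral_self_eq u (hg.integrable _)

theorem norm_bounded_sq (hg : IsBoundedMeasurable g) (u : H) :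
    ‖E.bounded g u‖ ^ 2 = ∫ s, g s ^ 2 ∂(E.complexMeasure u u).variation := by
  have h1 : inner ℂ (E.bounded g u) (E.bounded g u) =
      ((∫ s, g s ^ 2 ∂(E.complexMeasure u u).variation : ℝ) : ℂ) := by
    rw [inner_bounded_left hg, bounded_bounded hg hg, inner_bounded_self (hg.mul hg)]
    simp_rw [pow_two]
  rw [inner_self_eq_norm_sq_to_K] at h1
  exact Complex.ofReal_injective (by simpa using h1)

/-- A substitute for Cauchy–Schwarz, sufficient for integrability: `φ d|μ_{u,v}| ≤ φ² dμ_{u,u} +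
dμ_{v,v}`, obtained by taking as Young weight the value of a simple function on each of its level
sets. -/
theorem lintegral_variation_le (u v : H) (φ : Ω → ℝ≥0) :
    ∫⁻ s, φ s ∂(E.complexMeasure u v).variation ≤
      ∫⁻ s, (φ s : ENNReal) ^ 2 ∂(E.complexMeasure u u).variation +
        (E.complexMeasure v v).variation Set.univ := by
  rw [lintegral_eq_nnreal]
  refine iSup₂_le fun ψ hψ => ?_
  have h1 : (ψ.map ((↑) : ℝ≥0 → ENNReal)).lintegral (E.complexMeasure u v).variation ≤
      ((ψ ^ 2).map ((↑) : ℝ≥0 → ENNReal)).lintegral (E.complexMeasure u u).variation +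
        (E.complexMeasure v v).variation Set.univ := by
    rw [SimpleFunc.map_lintegral, show ψ ^ 2 = ψ.map (fun x => x ^ 2) from rfl,
      SimpleFunc.map_map, SimpleFunc.map_lintegral,
      ← SimpleFunc.sum_range_measure_preimage_singleton ψ, ← Finset.sum_add_distrib]
    refine Finset.sum_le_sum fun c _ => ?_
    simpa using E.mul_variation_le c u v (ψ ⁻¹' {c})
  refine h1.trans ?_
  gcongr
  rw [← SimpleFunc.lintegral_eq_lintegral]
  refine lintegral_mono fun x => ?_
  simp only [SimpleFunc.coe_map, Function.comp_apply, SimpleFunc.coe_pow, Pi.pow_apply]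
  push_cast
  gcongr
  exact_mod_cast hψ x

/-- Makes the integrability clause for each `v` in `integralGraph` a consequence of square
integrability. -/
theorem integrable_of_sq {φ : Ω → ℝ} (hφ : Measurable φ) {u : H}
    (h : (E.complexMeasure u u).Integrable fun s => φ s ^ 2) (v : H) :
    (E.complexMeasure u v).Integrable φ := by
  refine ⟨hφ.aestronglyMeasurable, ?_⟩
  refine (lintegral_variation_le u v fun s => ‖φ s‖₊).trans_lt ?_
  refine ENNReal.add_lt_top.2 ⟨?_, measure_lt_top _ _⟩
  have h1 : HasFiniteIntegral (fun s => φ s ^ 2) (E.complexMeasure u u).variation := h.2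
  rw [HasFiniteIntegral] at h1
  simpa [enorm_eq_nnnorm] using h1

/-! ### Cutoffs and the graph of an unbounded spectral integral. -/

/-- An increasing sequence of measurable sets exhausting the space. -/
structure IsCutoff (ω : ℕ → Set Ω) : Prop where
  measurableSet : ∀ n, MeasurableSet (ω n)
  mono : Monotone ω
  iUnion : ⋃ n, ω n = Set.univ

namespace IsCutoff

variable {ω : ℕ → Set Ω}

theorem tendsto_indicator (hω : IsCutoff ω) (φ : Ω → ℝ) (x : Ω) :
    Tendsto (fun n => (ω n).indicator φ x) atTop (𝓝 (φ x)) := by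
  obtain ⟨N, hN⟩ := Set.mem_iUnion.1 (hω.iUnion ▸ Set.mem_univ x)
  refine tendsto_const_nhds.congr' ?_
  filter_upwards [eventually_ge_atTop N] with n hn
  rw [Set.indicator_of_mem (hω.mono hn hN)]

theorem tendsto_inner (hω : IsCutoff ω) (E : SpectralMeasure Ω H) (u v : H) :
    Tendsto (fun n => inner ℂ v (E.toFun (ω n) u)) atTop (𝓝 (inner ℂ v u)) := by
  have h := tendsto_form (E := E) (F := fun n => (ω n).indicator fun _ => 1) (f := fun _ => 1)
    (C := 1) (fun n => measurable_const.indicator (hω.measurableSet n)) (fun n x => ?_)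
    (fun x => hω.tendsto_indicator _ x) u v
  · have h1 : (fun _ : Ω => (1 : ℝ)) = Set.univ.indicator fun _ => 1 := by simp
    rw [h1, form_indicator_const 1 .univ, E.univ] at h
    have h2 : ∀ n, E.form ((ω n).indicator fun _ => 1) u v = inner ℂ v (E.toFun (ω n) u) :=
      fun n => by rw [form_indicator_const 1 (hω.measurableSet n)]; simp
    simpa [h2] using h
  · exact (norm_indicator_le_norm_self _ _).trans (by simp)

/-- For projections weak convergence to the identity is already strong: `‖E(ω n)u - u‖² = ‖u‖² -
⟨E(ω n)u, u⟩`. -/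
theorem tendsto_toFun (hω : IsCutoff ω) (E : SpectralMeasure Ω H) (u : H) :
    Tendsto (fun n => E.toFun (ω n) u) atTop (𝓝 u) := by
  rw [tendsto_iff_norm_sub_tendsto_zero]
  have h : Tendsto (fun n => ‖E.toFun (ω n) u - u‖ ^ 2) atTop (𝓝 0) := by
    have h1 : ∀ n, ‖E.toFun (ω n) u - u‖ ^ 2 = ‖u‖ ^ 2 - (inner ℂ u (E.toFun (ω n) u)).re := by
      intro n
      have h2 : (inner ℂ u (E.toFun (ω n) u)).re = ‖E.toFun (ω n) u‖ ^ 2 := by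
        rw [inner_toFun_eq, inner_self_eq_norm_sq_to_K]
        norm_cast
      have h3 := norm_sub_sq (𝕜 := ℂ) (E.toFun (ω n) u) u
      rw [h3, ← inner_toFun_right]
      simp only [RCLike.re_to_complex]
      rw [h2]
      ring
    simp_rw [h1]
    have h4 := (Complex.continuous_re.tendsto _).comp (hω.tendsto_inner E u u)
    have h5 : (inner ℂ u u : ℂ).re = ‖u‖ ^ 2 := by
      rw [inner_self_eq_norm_sq_to_K]
      norm_cast
    rw [h5] at h4
    have h7 := h4.const_sub (‖u‖ ^ 2)
    rwa [sub_self] at h7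
  have h6 := (Real.continuous_sqrt.tendsto 0).comp h
  simpa [Function.comp_def, Real.sqrt_sq] using h6

theorem ext (hω : IsCutoff ω) (E : SpectralMeasure Ω H) {u v : H}
    (h : ∀ n, E.toFun (ω n) u = E.toFun (ω n) v) : u = v := by
  refine tendsto_nhds_unique (hω.tendsto_toFun E u) ?_
  simp_rw [h]
  exact hω.tendsto_toFun E v

/-- The graph of `∫ φ dE` in terms of the bounded operators `∫_{ω n} φ dE`. -/
theorem mem_integralGraph_iff (hω : IsCutoff ω) {φ : Ω → ℝ} (hφ : Measurable φ)
    (hb : ∀ n, IsBoundedMeasurable ((ω n).indicator φ)) (u w : H) :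
    (u, w) ∈ E.integralGraph φ ↔
      ∀ n, E.bounded ((ω n).indicator φ) u = E.toFun (ω n) w := by
  constructor
  · intro h n
    refine ext_inner_left ℂ fun v => ?_
    rw [inner_bounded (hb n), ← form_toFun_right (hω.measurableSet n), inner_toFun_right]
    exact (h.2 _).2.symm
  · intro h
    have h1 : (E.complexMeasure u u).Integrable fun s => φ s ^ 2 := by
      refine ⟨(hφ.pow_const 2).aestronglyMeasurable, ?_⟩
      -- The truncated `L²` norm equals `‖E(ω n) w‖ ≤ ‖w‖`, uniformly in `n`; monotone convergence
      -- then puts `φ` in `L²(μ_{u,u})`.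
      have h2 : ∀ n, ∫⁻ s, ‖(ω n).indicator φ s ^ 2‖ₑ ∂(E.complexMeasure u u).variation ≤
          ENNReal.ofReal (‖w‖ ^ 2) := by
        intro n
        have h3 := norm_bounded_sq (E := E) (hb n) u
        have h4 : Integrable (fun s => (ω n).indicator φ s ^ 2)
            (E.complexMeasure u u).variation := by
          simp_rw [pow_two]
          exact ((hb n).mul (hb n)).integrable _
        have h5 : ∫⁻ s, ‖(ω n).indicator φ s ^ 2‖ₑ ∂(E.complexMeasure u u).variation =
            ENNReal.ofReal (∫ s, (ω n).indicator φ s ^ 2 ∂(E.complexMeasure u u).variation) := by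
          rw [ofReal_integral_eq_lintegral_ofReal h4 (ae_of_all _ fun s => sq_nonneg _)]
          refine lintegral_congr fun s => ?_
          rw [Real.enorm_of_nonneg (sq_nonneg _)]
        rw [h5, ← h3, h n]
        exact ENNReal.ofReal_le_ofReal (pow_le_pow_left₀ (norm_nonneg _) (E.norm_toFun_le _ _) 2)
      have h6 := lintegral_tendsto_of_tendsto_of_monotone
        (μ := (E.complexMeasure u u).variation)
        (f := fun n s => ‖(ω n).indicator φ s ^ 2‖ₑ) (F := fun s => ‖φ s ^ 2‖ₑ)
        (fun n => (((hb n).measurable.pow_const 2).enorm).aemeasurable)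
        (ae_of_all _ fun s m n hmn => ?_) (ae_of_all _ fun s => ?_)
      · exact (le_of_tendsto' h6 h2).trans_lt ENNReal.ofReal_lt_top
      · by_cases hs : s ∈ ω m
        · simp [hs, hω.mono hmn hs]
        · simp [hs]
      · exact (continuous_enorm.tendsto _).comp ((hω.tendsto_indicator φ s).pow 2)
    refine ⟨h1, fun v => ⟨integrable_of_sq hφ h1 v, ?_⟩⟩
    have h7 : Tendsto (fun n => E.form ((ω n).indicator φ) u v) atTop (𝓝 (E.form φ u v)) := by
      refine VectorMeasure.tendsto_integral_of_dominated_convergence (fun s => ‖φ s‖)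
        (fun n => (hb n).measurable.aestronglyMeasurable) (integrable_of_sq hφ h1 v).norm
        (fun n => ae_of_all _ fun s => norm_indicator_le_norm_self _ _)
        (ae_of_all _ fun s => hω.tendsto_indicator φ s)
    refine tendsto_nhds_unique (hω.tendsto_inner E w v) ?_
    simp_rw [← h, inner_bounded (hb _)]
    exact h7

end IsCutoff

end SpectralMeasure

/-! ### Semigroups generated by compatible sequences of bounded dissipative operators -/

/-- Since `b` commutes with `p`, it preserves the range of `p`, on which `a` and `b` coincide; so
all their powers, hence their exponential series, coincide there. -/
theorem NormedSpace.exp_mul_eq_exp_mul {𝔸 : Type*} [NormedRing 𝔸] [NormedAlgebra ℝ 𝔸]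
    [CompleteSpace 𝔸] {a b p : 𝔸} (h : a * p = b * p) (hb : Commute b p) :
    NormedSpace.exp a * p = NormedSpace.exp b * p := by
  have hk : ∀ k : ℕ, a ^ k * p = b ^ k * p := by
    intro k
    induction k with
    | zero => simp
    | succ k ih =>
      rw [pow_succ', mul_assoc, ih, (hb.pow_left k).eq, ← mul_assoc, h, mul_assoc,
        ← (hb.pow_left k).eq, ← mul_assoc, ← pow_succ']
  refine ((NormedSpace.exp_series_hasSum_exp' (𝕂 := ℝ) a).mul_right p).unique ?_
  convert (NormedSpace.exp_series_hasSum_exp' (𝕂 := ℝ) b).mul_right p using 2 with k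
  rw [smul_mul_assoc, smul_mul_assoc, hk]

section BoundedGenerator

variable {X : Type*} [NormedAddCommGroup X] [InnerProductSpace ℂ X] [CompleteSpace X]

/-- The semigroup `e^{tG}` of a bounded operator. -/
noncomputable def expSemigroup (G : X →L[ℂ] X) (t : ℝ) : X →L[ℂ] X := NormedSpace.exp (t • G)

theorem expSemigroup_zero (G : X →L[ℂ] X) : expSemigroup G 0 = 1 := by
  simp [expSemigroup]

theorem expSemigroup_add (G : X →L[ℂ] X) (s t : ℝ) :
    expSemigroup G (s + t) = expSemigroup G s * expSemigroup G t := by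
  rw [expSemigroup, add_smul]
  have hr : ∀ T : X →L[ℂ] X,
      T ∈ Metric.eball 0 (NormedSpace.expSeries ℝ (X →L[ℂ] X)).radius := fun T => by
    rw [NormedSpace.expSeries_radius_eq_top]
    exact edist_lt_top _ _
  exact NormedSpace.exp_add_of_commute_of_mem_ball (𝕂 := ℝ)
    (((Commute.refl G).smul_left s).smul_right t) (hr _) (hr _)

theorem hasDerivAt_expSemigroup (G : X →L[ℂ] X) (x : X) (t : ℝ) :
    HasDerivAt (fun r => expSemigroup G r x) (expSemigroup G t (G x)) t := by
  have h := hasDerivAt_exp_smul_const (𝕂 := ℝ) G t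
  exact (((ContinuousLinearMap.apply ℂ X x).restrictScalars ℝ).hasFDerivAt).comp_hasDerivAt t h

theorem commute_expSemigroup (G : X →L[ℂ] X) {Q : X →L[ℂ] X} (h : Commute Q G) (t : ℝ) :
    Commute Q (expSemigroup G t) :=
  (h.smul_right t).exp_right

/-- The derivative of `‖e^{rG}x‖²` is `2 Re ⟨G y, y⟩ ≤ 0` at `y = e^{rG}x`. -/
theorem norm_expSemigroup_apply_le {G : X →L[ℂ] X} (hG : ∀ x, (inner ℂ x (G x)).re ≤ 0) {t : ℝ}
    (ht : 0 ≤ t) (x : X) : ‖expSemigroup G t x‖ ≤ ‖x‖ := by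
  have hc : ∀ r, expSemigroup G r (G x) = G (expSemigroup G r x) := fun r =>
    (DFunLike.congr_fun (commute_expSemigroup G (Commute.refl G) r).eq x).symm
  let _ : InnerProductSpace ℝ X := InnerProductSpace.rclikeToReal ℂ X
  have h1 : ∀ r, HasDerivAt (fun r => ‖expSemigroup G r x‖ ^ 2)
      (2 * inner ℝ (expSemigroup G r x) (expSemigroup G r (G x))) r := fun r =>
    (hasDerivAt_expSemigroup G x r).norm_sq
  have h2 : Antitone fun r => ‖expSemigroup G r x‖ ^ 2 := by
    refine antitone_of_hasDerivAt_nonpos h1 fun r => ?_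
    rw [hc]
    have := hG (expSemigroup G r x)
    have h3 : inner ℝ (expSemigroup G r x) (G (expSemigroup G r x)) =
      (inner ℂ (expSemigroup G r x) (G (expSemigroup G r x))).re := rfl
    rw [Pi.zero_apply, h3]
    linarith
  have h4 := h2 ht
  simp only [expSemigroup_zero, one_apply_eq_self] at h4
  exact le_of_sq_le_sq h4 (norm_nonneg _)

/-- A sequence of bounded dissipative operators `G n = G (n + 1) P n`, compatible with contractions
`P n` which converge strongly to the identity. -/
structure TruncatedGenerator (X : Type*) [NormedAddCommGroup X] [InnerProductSpace ℂ X] where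
  P : ℕ → X →L[ℂ] X
  G : ℕ → X →L[ℂ] X
  norm_P_le : ∀ n x, ‖P n x‖ ≤ ‖x‖
  tendsto_P : ∀ x, Tendsto (fun n => P n x) atTop (𝓝 x)
  commute : ∀ m n, Commute (P m) (G n)
  G_mul_P : ∀ m n, m ≤ n → G n * P m = G m
  dissipative : ∀ n x, (inner ℂ x (G n x)).re ≤ 0

namespace TruncatedGenerator

theorem tendsto_norm_sub_P {X : Type*} [NormedAddCommGroup X] [InnerProductSpace ℂ X]
    (D : TruncatedGenerator X) (x : X) :
    Tendsto (fun n => 2 * ‖x - D.P n x‖) atTop (𝓝 0) := by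
  have h := ((D.tendsto_P x).const_sub x).norm.const_mul 2
  simpa using h

variable (D : TruncatedGenerator X)

theorem expSemigroup_P {m n : ℕ} (hmn : m ≤ n) (t : ℝ) (x : X) :
    expSemigroup (D.G n) t (D.P m x) = expSemigroup (D.G m) t (D.P m x) := by
  have h := NormedSpace.exp_mul_eq_exp_mul (a := t • D.G n) (b := t • D.G m) (p := D.P m)
    (by rw [smul_mul_assoc, smul_mul_assoc, D.G_mul_P m n hmn, D.G_mul_P m m le_rfl])
    ((D.commute m m).symm.smul_left t)
  exact DFunLike.congr_fun h x

/-- The two exponentials agree on `P m x`, so only `x - P m x` contributes, once for each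
contraction. The bound does not depend on `t`, which later transfers continuity at `0` to the limit.
-/
theorem norm_sub_le {m n : ℕ} (hmn : m ≤ n) {t : ℝ} (ht : 0 ≤ t) (x : X) :
    ‖expSemigroup (D.G n) t x - expSemigroup (D.G m) t x‖ ≤ 2 * ‖x - D.P m x‖ := by
  have h1 : expSemigroup (D.G n) t x - expSemigroup (D.G m) t x =
      expSemigroup (D.G n) t (x - D.P m x) - expSemigroup (D.G m) t (x - D.P m x) := by
    rw [map_sub, map_sub, D.expSemigroup_P hmn]
    abel
  rw [h1, two_mul]
  exact (_root_.norm_sub_le _ _).trans (add_le_add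
    (norm_expSemigroup_apply_le (D.dissipative n) ht _)
    (norm_expSemigroup_apply_le (D.dissipative m) ht _))

theorem exists_limit {t : ℝ} (ht : 0 ≤ t) (x : X) :
    ∃ y, Tendsto (fun n => expSemigroup (D.G n) t x) atTop (𝓝 y) := by
  refine cauchySeq_tendsto_of_complete ?_
  rw [Metric.cauchySeq_iff']
  intro ε hε
  obtain ⟨N, hN⟩ := ((D.tendsto_norm_sub_P x).eventually_lt_const hε).exists
  exact ⟨N, fun n hn => by rw [dist_eq_norm]; exact (D.norm_sub_le hn ht x).trans_lt hN⟩

/-- The strong limit of the semigroups `e^{t G n}`. -/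
noncomputable def limit (t : ℝ≥0) : X →L[ℂ] X :=
  continuousLinearMapOfTendsto (fun n => expSemigroup (D.G n) t)
    (f := fun x => (D.exists_limit t.2 x).choose)
    (tendsto_pi_nhds.2 fun x => (D.exists_limit t.2 x).choose_spec)

theorem tendsto_limit (t : ℝ≥0) (x : X) :
    Tendsto (fun n => expSemigroup (D.G n) t x) atTop (𝓝 (D.limit t x)) :=
  (D.exists_limit t.2 x).choose_spec

theorem norm_limit_le (t : ℝ≥0) (x : X) : ‖D.limit t x‖ ≤ ‖x‖ :=
  le_of_tendsto' (D.tendsto_limit t x).norm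
    fun n => norm_expSemigroup_apply_le (D.dissipative n) t.2 x

theorem norm_limit_sub_le (m : ℕ) (t : ℝ≥0) (x : X) :
    ‖D.limit t x - expSemigroup (D.G m) t x‖ ≤ 2 * ‖x - D.P m x‖ := by
  refine le_of_tendsto ((D.tendsto_limit t x).sub_const _).norm ?_
  filter_upwards [eventually_ge_atTop m] with n hn
  exact D.norm_sub_le hn t.2 x

theorem limit_P (n : ℕ) (t : ℝ≥0) (x : X) :
    D.limit t (D.P n x) = expSemigroup (D.G n) t (D.P n x) := by
  refine tendsto_nhds_unique (D.tendsto_limit t _) (tendsto_const_nhds.congr' ?_)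
  filter_upwards [eventually_ge_atTop n] with k hk
  exact (D.expSemigroup_P hk t x).symm

theorem P_limit (n : ℕ) (t : ℝ≥0) (x : X) :
    D.P n (D.limit t x) = D.limit t (D.P n x) := by
  refine tendsto_nhds_unique (((D.P n).continuous.tendsto _).comp (D.tendsto_limit t x))
    ((D.tendsto_limit t (D.P n x)).congr fun k => ?_)
  exact (DFunLike.congr_fun (commute_expSemigroup (D.G k) (D.commute n k) t).eq x).symm

theorem limit_add (s t : ℝ≥0) (x : X) : D.limit (s + t) x = D.limit s (D.limit t x) := by
  refine tendsto_nhds_unique (D.tendsto_limit (s + t) x) ?_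
  have h1 := D.tendsto_limit s (D.limit t x)
  refine h1.congr_dist ?_
  have h2 : Tendsto (fun n => dist (D.limit t x) (expSemigroup (D.G n) t x)) atTop (𝓝 0) := by
    simpa using (tendsto_const_nhds (x := D.limit t x)).dist (D.tendsto_limit t x)
  -- Contractivity of `e^{s G n}` absorbs replacing the limit at time `t` by its `n`-th
  -- approximation.
  refine squeeze_zero (fun _ => dist_nonneg) (fun n => ?_) h2
  have h3 : expSemigroup (D.G n) ((s + t : ℝ≥0) : ℝ) x =
      expSemigroup (D.G n) s (expSemigroup (D.G n) t x) := by
    rw [NNReal.coe_add, expSemigroup_add]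
    rfl
  rw [h3, dist_eq_norm, dist_eq_norm, ← map_sub]
  exact norm_expSemigroup_apply_le (D.dissipative n) s.2 _

theorem tendsto_limit_zero (x : X) : Tendsto (fun t => D.limit t x) (𝓝 0) (𝓝 x) := by
  rw [Metric.tendsto_nhds]
  intro ε hε
  obtain ⟨m, hm⟩ := ((D.tendsto_norm_sub_P x).eventually_lt_const (half_pos hε)).exists
  have h1 : Tendsto (fun t : ℝ≥0 => expSemigroup (D.G m) t x) (𝓝 0) (𝓝 x) := by
    have h2 := ((hasDerivAt_expSemigroup (D.G m) x 0).continuousAt.tendsto).comp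
      (NNReal.continuous_coe.tendsto 0)
    simpa [expSemigroup_zero, Function.comp_def] using h2
  filter_upwards [Metric.tendsto_nhds.1 h1 _ (half_pos hε)] with t ht
  have h3 := D.norm_limit_sub_le m t x
  rw [← dist_eq_norm] at h3
  linarith [dist_triangle (D.limit t x) (expSemigroup (D.G m) t x) x]

/-- The contraction semigroup obtained as the strong limit of the semigroups `e^{t G n}`. -/
noncomputable def semigroup : ContractionSemigroup X where
  toFun := D.limit
  map_zero := by
    ext x
    refine tendsto_nhds_unique (D.tendsto_limit 0 x) ?_
    simp [expSemigroup_zero]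
  map_add s t := by
    ext x
    exact D.limit_add s t x
  tendsto_zero x := (D.tendsto_limit_zero x).mono_left nhdsWithin_le_nhds
  norm_le_one t := ContinuousLinearMap.opNorm_le_bound _ zero_le_one fun x => by
    rw [one_mul]; exact D.norm_limit_le t x

/-- Plays the role of `S(t)x - x = ∫₀ᵗ S(r)y dr`. The function `r ↦ e^{r G n} P n x - r P n y` has
derivative `P n (S(r)y - y)`, of norm at most `ε`; the mean value inequality applies, and then `n →
∞`. -/
theorem norm_limit_sub_sub_le {x y : X} (h : ∀ n, D.G n x = D.P n y) {ε : ℝ} (t : ℝ≥0)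
    (hε : ∀ r : ℝ≥0, r ≤ t → ‖D.limit r y - y‖ ≤ ε) :
    ‖D.limit t x - x - (t : ℝ) • y‖ ≤ ε * t := by
  have h1 : ∀ n, ‖expSemigroup (D.G n) t (D.P n x) - D.P n x - (t : ℝ) • D.P n y‖ ≤ ε * t := by
    intro n
    have hGP : D.G n (D.P n x) = D.P n y := by
      rw [← h n]
      exact DFunLike.congr_fun (D.G_mul_P n n le_rfl) x
    have h2 : ∀ r : ℝ, HasDerivAt
        (fun r : ℝ => expSemigroup (D.G n) r (D.P n x) - r • D.P n y)
        (expSemigroup (D.G n) r (D.P n y) - D.P n y) r := by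
      intro r
      have h3 := hasDerivAt_expSemigroup (D.G n) (D.P n x) r
      rw [hGP] at h3
      have h4 := (hasDerivAt_id r).smul_const (D.P n y)
      rw [one_smul] at h4
      exact h3.sub h4
    have h5 := norm_image_sub_le_of_norm_deriv_le_segment' (a := 0) (b := t) (C := ε)
      (fun r _ => (h2 r).hasDerivWithinAt) (fun r hr => ?_) t ⟨t.2, le_rfl⟩
    · simp only [expSemigroup_zero, one_apply_eq_self, zero_smul, sub_zero] at h5
      rwa [sub_right_comm] at h5
    · lift r to ℝ≥0 using hr.1
      rw [← D.limit_P, ← D.P_limit, ← map_sub]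
      exact (D.norm_P_le _ _).trans (hε r (NNReal.coe_lt_coe.1 hr.2).le)
  have h7 : Tendsto (fun n => expSemigroup (D.G n) t (D.P n x)) atTop (𝓝 (D.limit t x)) := by
    simp_rw [← D.limit_P]
    exact ((D.limit t).continuous.tendsto _).comp (D.tendsto_P x)
  exact le_of_tendsto' ((h7.sub (D.tendsto_P x)).sub ((D.tendsto_P y).const_smul (t : ℝ))).norm h1

theorem mem_generatorGraph_iff (p : X × X) :
    p ∈ D.semigroup.generatorGraph ↔ ∀ n, D.G n p.1 = D.P n p.2 := by
  obtain ⟨x, y⟩ := p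
  change Tendsto (fun t : ℝ≥0 => ((t : ℝ) : ℂ)⁻¹ • (D.limit t x - x)) (𝓝[>] 0) (𝓝 y) ↔ _
  constructor
  -- Applying `P n` to the difference quotient replaces the limit semigroup by `e^{t G n}`, which is
  -- differentiable in norm.
  · intro h n
    have h1 : Tendsto (fun t : ℝ≥0 => ((t : ℝ) : ℂ)⁻¹ •
        (expSemigroup (D.G n) t (D.P n x) - D.P n x)) (𝓝[>] 0) (𝓝 (D.P n y)) := by
      refine (((D.P n).continuous.tendsto _).comp h).congr fun t => ?_
      simp only [Function.comp_apply, map_smul, map_sub, D.P_limit, D.limit_P]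
    have h2 := (hasDerivAt_expSemigroup (D.G n) (D.P n x) 0).tendsto_slope_zero_right
    simp only [expSemigroup_zero, one_apply_eq_self, zero_add] at h2
    have h3 : Tendsto (fun t : ℝ≥0 => (t : ℝ)) (𝓝[>] 0) (𝓝[>] 0) := by
      refine tendsto_nhdsWithin_iff.2 ⟨(NNReal.continuous_coe.tendsto 0).mono_left
        nhdsWithin_le_nhds, ?_⟩
      filter_upwards [self_mem_nhdsWithin] with t ht
      exact_mod_cast ht
    have h4 := h2.comp h3
    have h5 : D.G n (D.P n x) = D.P n y := by
      refine tendsto_nhds_unique h4 (h1.congr fun t => ?_)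
      rw [← Complex.ofReal_inv, Complex.coe_smul]
      rfl
    rw [← h5]
    exact (DFunLike.congr_fun (D.G_mul_P n n le_rfl) x).symm
  -- The remainder estimate applies because `S(r)y` is close to `y` for small `r`.
  · intro h
    rw [Metric.tendsto_nhds]
    intro ε hε
    obtain ⟨δ, hδ, hball⟩ := Metric.eventually_nhds_iff.1
      (Metric.tendsto_nhds.1 (D.tendsto_limit_zero y) (ε / 2) (half_pos hε))
    have h1 : ∀ᶠ t : ℝ≥0 in 𝓝[>] 0, dist t 0 < δ :=
      (Metric.eventually_nhds_iff.2 ⟨δ, hδ, fun _ h => h⟩).filter_mono nhdsWithin_le_nhds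
    filter_upwards [h1, self_mem_nhdsWithin] with t ht ht0
    have ht0' : (0 : ℝ) < t := by exact_mod_cast ht0
    have h2 := D.norm_limit_sub_sub_le h (ε := ε / 2) t fun r hr => by
      have hr' : dist r 0 < δ := by
        refine lt_of_le_of_lt ?_ ht
        rw [NNReal.dist_eq, NNReal.dist_eq]
        simpa using hr
      have := hball hr'
      rw [dist_eq_norm] at this
      exact this.le
    have h3 : ((t : ℝ) : ℂ)⁻¹ • (D.limit t x - x) - y =
        (t : ℝ)⁻¹ • (D.limit t x - x - (t : ℝ) • y) := by
      rw [← Complex.ofReal_inv, Complex.coe_smul, smul_sub _ (_ - _), smul_smul, inv_mul_cancel₀ ht0'.ne',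
        one_smul]
    rw [dist_eq_norm, h3, norm_smul, Real.norm_of_nonneg (by positivity), inv_mul_lt_iff₀ ht0']
    nlinarith

end TruncatedGenerator

end BoundedGenerator

/-! ### The bounded inverse of a strictly positive operator -/

namespace StrictlyPositiveOperator

variable {H : Type*} [NormedAddCommGroup H] [InnerProductSpace ℂ H] [CompleteSpace H]

theorem exists_inverse (A : StrictlyPositiveOperator H) :
    ∃ T : H →L[ℂ] H, ∀ u w : H, (u, w) ∈ A.op.graph ↔ T w = u := by
  have h0 : ((0 : ℝ) : ℂ) ∈ A.op.unboundedResolventSet := by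
    by_contra h
    exact lt_irrefl _ (A.pos_of_mem_spectrum (s := 0) h)
  obtain ⟨R, h1, h2⟩ := h0
  -- `R` inverts `0 - A`, hence the sign.
  refine ⟨-R, fun u w => ?_⟩
  rw [LinearPMap.mem_graph_iff]
  constructor
  · rintro ⟨v, rfl, rfl⟩
    have h3 := h2 v
    simp only [Complex.ofReal_zero, zero_smul, zero_sub, map_neg] at h3
    simpa using h3
  · rintro rfl
    obtain ⟨v, h3, h4⟩ := h1 w
    refine ⟨-v, ?_, ?_⟩
    · simp [h3]
    · simpa [LinearPMap.map_neg] using h4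

/-- The bounded inverse `A⁻¹`. -/
noncomputable def inverse (A : StrictlyPositiveOperator H) : H →L[ℂ] H := A.exists_inverse.choose

theorem mem_graph_iff (A : StrictlyPositiveOperator H) (u w : H) :
    (u, w) ∈ A.op.graph ↔ A.inverse w = u := A.exists_inverse.choose_spec u w

theorem inverse_injective (A : StrictlyPositiveOperator H) : Function.Injective A.inverse := by
  rw [injective_iff_map_eq_zero]
  intro w hw
  obtain ⟨u, h1, h2⟩ := (LinearPMap.mem_graph_iff _).1 ((A.mem_graph_iff 0 w).2 hw)
  simp only [ZeroMemClass.coe_eq_zero] at h1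
  rw [h1, LinearPMap.map_zero] at h2
  exact h2.symm

theorem isSelfAdjoint_inverse (A : StrictlyPositiveOperator H) : IsSelfAdjoint A.inverse := by
  rw [ContinuousLinearMap.isSelfAdjoint_iff_isSymmetric]
  intro x y
  obtain ⟨u, hu1, hu2⟩ := (LinearPMap.mem_graph_iff _).1 ((A.mem_graph_iff _ x).2 rfl)
  obtain ⟨v, hv1, hv2⟩ := (LinearPMap.mem_graph_iff _).1 ((A.mem_graph_iff _ y).2 rfl)
  have h := LinearPMap.adjoint_isFormalAdjoint A.isSelfAdjoint.dense_domain (T := A.op)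
  rw [LinearPMap.isSelfAdjoint_def.1 A.isSelfAdjoint] at h
  have h1 := h u v
  rw [hu1, hv1, hu2, hv2] at h1
  exact h1.symm

/-- Based on the factorisation `(s - A) T = s T - 1` with `T = A⁻¹`: invertibility of `s - A` on the
domain of `A` is invertibility of `s T - 1` on `H`. -/
theorem mem_spectrum_iff (A : StrictlyPositiveOperator H) (s : ℝ) :
    s ∈ A.spectrum ↔ s ≠ 0 ∧ s⁻¹ ∈ _root_.spectrum ℝ A.inverse := by
  set T := A.inverse with hT
  rcases eq_or_ne s 0 with rfl | hs
  · simp only [ne_eq, not_true_eq_false, false_and, iff_false]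
    exact fun h => lt_irrefl _ (A.pos_of_mem_spectrum h)
  have hu : s⁻¹ ∈ _root_.spectrum ℝ T ↔ ¬ IsUnit ((s : ℂ) • T - 1) := by
    rw [spectrum.mem_iff, not_iff_not, ← isUnit_smul_iff (Units.mk0 (-(s : ℂ)) (by simpa using hs))]
    have h1 : (Units.mk0 (-(s : ℂ)) (by simpa using hs)) •
        (algebraMap ℝ (H →L[ℂ] H) s⁻¹ - T) = (s : ℂ) • T - 1 := by
      rw [Units.smul_mk0, smul_sub, IsScalarTower.algebraMap_apply ℝ ℂ (H →L[ℂ] H),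
        Algebra.algebraMap_eq_smul_one, smul_smul]
      have h2 : -(s : ℂ) * (algebraMap ℝ ℂ) s⁻¹ = -1 := by
        have : (s : ℂ) ≠ 0 := by exact_mod_cast hs
        simp [this]
      rw [h2]
      module
    rw [h1]
  rw [hu]
  simp only [ne_eq, hs, not_false_eq_true, true_and]
  change (s : ℂ) ∉ A.op.unboundedResolventSet ↔ _
  rw [not_iff_not]
  have hop : ∀ u : A.op.domain, T (A.op u) = u := fun u =>
    (A.mem_graph_iff _ _).1 ((LinearPMap.mem_graph_iff _).2 ⟨u, rfl, rfl⟩)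
  have hex : ∀ x, ∃ u : A.op.domain, (u : H) = T x ∧ A.op u = x := fun x =>
    (LinearPMap.mem_graph_iff _).1 ((A.mem_graph_iff _ x).2 rfl)
  constructor
  · rintro ⟨R, h1, h2⟩
    -- The candidate inverse is `s R - 1 = A R`.
    refine isUnit_iff_exists.2 ⟨(s : ℂ) • R - 1, ?_, ?_⟩
    · ext x
      obtain ⟨u, hu1, hu2⟩ := h1 x
      have h3 : ((s : ℂ) • R - 1) x = A.op u := by
        simp only [sub_apply, smul_apply, one_apply_eq_self, hu1]
        nth_rewrite 1 [← hu2]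
        abel
      rw [mul_apply_eq_comp, h3]
      simp only [sub_apply, smul_apply,
          one_apply_eq_self, hop, hu2]
    · ext x
      obtain ⟨u, hu1, hu2⟩ := hex x
      have h3 := h2 u
      rw [hu1, hu2] at h3
      simp only [mul_apply_eq_comp, sub_apply,
        smul_apply, one_apply_eq_self, h3]
      abel
  · intro h
    obtain ⟨B, hB1, hB2⟩ := isUnit_iff_exists.1 h
    have hB1' : ∀ x, (s : ℂ) • T (B x) - B x = x := fun x => DFunLike.congr_fun hB1 x
    have hB2' : ∀ x, B ((s : ℂ) • T x - x) = x := fun x => DFunLike.congr_fun hB2 x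
    refine ⟨T * B, fun x => ?_, fun u => ?_⟩
    · obtain ⟨u, hu1, hu2⟩ := hex (B x)
      refine ⟨u, hu1.symm, ?_⟩
      rw [hu1, hu2, hB1']
    · rw [mul_apply_eq_comp]
      nth_rewrite 1 [← hop u]
      rw [hB2', hop]

/-- The spectrum of `A` avoids a neighbourhood of `0` because that of `A⁻¹` is bounded. The factor
`‖1‖` differs from `1` only for trivial `H`. -/
theorem exists_inv_le (A : StrictlyPositiveOperator H) :
    ∃ C : ℝ, 0 ≤ C ∧ ∀ s ∈ A.spectrum, s⁻¹ ≤ C := by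
  refine ⟨‖A.inverse‖ * ‖(1 : H →L[ℂ] H)‖, by positivity, fun s hs => ?_⟩
  exact (le_abs_self _).trans
    (spectrum.norm_le_norm_mul_of_mem ((A.mem_spectrum_iff s).1 hs).2)

end StrictlyPositiveOperator

/-! ### The truncated wave operator -/

section Wave

variable {H K : Type*} [NormedAddCommGroup H] [InnerProductSpace ℂ H]
  [NormedAddCommGroup K] [InnerProductSpace ℂ K]

theorem WithLp.prod_ext {α β : Type*} {x y : WithLp 2 (α × β)} (h₁ : x.fst = y.fst)
    (h₂ : x.snd = y.snd) : x = y :=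
  WithLp.ofLp_injective 2 (Prod.ext h₁ h₂)

/-- The truncations of the operator `(u, v) ↦ (v, -(A u + f(A) v))` on `K × H`, where
`U : K ≃ H` plays the role of `A^{1/2}`, and `E n`, `R n`, `F n` are the truncations of the
identity, of `A^{1/2}` and of `f(A)`. -/
noncomputable def truncatedWave (U : K ≃ₗᵢ[ℂ] H) (E R F : ℕ → H →L[ℂ] H)
    (hE : ∀ n x, ‖E n x‖ ≤ ‖x‖) (hE' : ∀ x, Tendsto (fun n => E n x) atTop (𝓝 x))
    (hER : ∀ m n x, E m (R n x) = R n (E m x)) (hEF : ∀ m n x, E m (F n x) = F n (E m x))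
    (hRE : ∀ m n x, m ≤ n → R n (E m x) = R m x) (hFE : ∀ m n x, m ≤ n → F n (E m x) = F m x)
    (hR : ∀ n x y, inner ℂ (R n x) y = inner ℂ x (R n y))
    (hF : ∀ n x, 0 ≤ (inner ℂ x (F n x)).re) : TruncatedGenerator (WithLp 2 (K × H)) where
  P n := (WithLp.prodContinuousLinearEquiv 2 ℂ K H).symm.toContinuousLinearMap ∘L
    (((U.symm.toContinuousLinearEquiv.toContinuousLinearMap ∘L E n ∘L
      U.toContinuousLinearEquiv.toContinuousLinearMap) ∘L ContinuousLinearMap.fst ℂ K H).prod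
      (E n ∘L ContinuousLinearMap.snd ℂ K H)) ∘L
    (WithLp.prodContinuousLinearEquiv 2 ℂ K H).toContinuousLinearMap
  G n := (WithLp.prodContinuousLinearEquiv 2 ℂ K H).symm.toContinuousLinearMap ∘L
    (((U.symm.toContinuousLinearEquiv.toContinuousLinearMap ∘L R n) ∘L
      ContinuousLinearMap.snd ℂ K H).prod
      (-(R n ∘L U.toContinuousLinearEquiv.toContinuousLinearMap ∘L ContinuousLinearMap.fst ℂ K H +
        F n ∘L ContinuousLinearMap.snd ℂ K H))) ∘L
    (WithLp.prodContinuousLinearEquiv 2 ℂ K H).toContinuousLinearMap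
  norm_P_le n x := by
    refine le_of_sq_le_sq ?_ (norm_nonneg _)
    rw [WithLp.prod_norm_sq_eq_of_L2, WithLp.prod_norm_sq_eq_of_L2]
    refine add_le_add (pow_le_pow_left₀ (norm_nonneg _) ?_ 2)
      (pow_le_pow_left₀ (norm_nonneg _) (hE n _) 2)
    refine (U.symm.norm_map _).le.trans ((hE n _).trans (U.norm_map _).le)
  tendsto_P x := by
    refine ((WithLp.prodContinuousLinearEquiv 2 ℂ K H).symm.continuous.tendsto
      (x.fst, x.snd)).comp ?_
    refine Tendsto.prodMk_nhds ?_ (hE' _)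
    have h := (U.symm.continuous.tendsto _).comp (hE' (U x.fst))
    rwa [U.symm_apply_apply] at h
  commute m n := by
    ext x
    refine WithLp.prod_ext ?_ ?_
    · change U.symm (E m (U (U.symm (R n x.snd)))) = U.symm (R n (E m x.snd))
      rw [U.apply_symm_apply, hER]
    · change E m (-(R n (U x.fst) + F n x.snd)) =
        -(R n (U (U.symm (E m (U x.fst)))) + F n (E m x.snd))
      rw [U.apply_symm_apply, map_neg, map_add, hER, hEF]
  G_mul_P m n hmn := by
    ext x
    refine WithLp.prod_ext ?_ ?_
    · change U.symm (R n (E m x.snd)) = U.symm (R m x.snd)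
      rw [hRE m n _ hmn]
    · change -(R n (U (U.symm (E m (U x.fst)))) + F n (E m x.snd)) =
        -(R m (U x.fst) + F m x.snd)
      rw [U.apply_symm_apply, hRE m n _ hmn, hFE m n _ hmn]
  dissipative n x := by
    rw [WithLp.prod_inner_apply]
    change (inner ℂ x.fst (U.symm (R n x.snd)) +
      inner ℂ x.snd (-(R n (U x.fst) + F n x.snd))).re ≤ 0
    -- By symmetry of `R n`, the two cross terms are conjugate up to sign, so their real parts
    -- cancel and only the damping term survives.
    rw [← U.inner_map_map, U.apply_symm_apply, inner_neg_right, inner_add_right, ← hR,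
      ← inner_conj_symm]
    have := hF n x.snd
    simp only [Complex.add_re, Complex.neg_re, Complex.conj_re]
    linarith

end Wave

/-! ### Identification of the limit generator with the wave operator. -/

namespace StrictlyPositiveOperator

variable {H : Type*} [NormedAddCommGroup H] [InnerProductSpace ℂ H] [CompleteSpace H]
  {A : StrictlyPositiveOperator H}

theorem measurable_sqrt_coe : Measurable fun s : A.spectrum => √(s : ℝ) :=
  Real.continuous_sqrt.measurable.comp measurable_subtype_coe

theorem measurable_damping (f : C(A.spectrum, ℝ≥0)) : Measurable fun s => (f s : ℝ) :=
  (NNReal.continuous_coe.comp f.continuous).measurable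

theorem isBoundedMeasurable_inv_sqrt :
    IsBoundedMeasurable fun s : A.spectrum => (√(s : ℝ))⁻¹ := by
  obtain ⟨C, hC0, hC⟩ := A.exists_inv_le
  refine ⟨measurable_sqrt_coe.inv, √C, fun s => ?_⟩
  rw [Real.norm_of_nonneg (by positivity), ← Real.sqrt_inv]
  exact Real.sqrt_le_sqrt (hC s s.2)

/-- The part of the spectrum on which `s` and `f s` are at most `n`. -/
def cutoff (f : C(A.spectrum, ℝ≥0)) (n : ℕ) : Set A.spectrum := {s | (s : ℝ) ≤ n ∧ (f s : ℝ) ≤ n}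

theorem isCutoff_cutoff (f : C(A.spectrum, ℝ≥0)) : SpectralMeasure.IsCutoff (cutoff f) where
  measurableSet n := (measurableSet_le measurable_subtype_coe measurable_const).inter
    (measurableSet_le (measurable_damping f) measurable_const)
  mono m n hmn s hs := by
    have : (m : ℝ) ≤ n := by exact_mod_cast hmn
    exact ⟨hs.1.trans this, hs.2.trans this⟩
  iUnion := by
    refine Set.eq_univ_of_forall fun s => ?_
    obtain ⟨n, hn⟩ := exists_nat_ge (max (s : ℝ) (f s))
    exact Set.mem_iUnion.2 ⟨n, (le_max_left _ _).trans hn, (le_max_right _ _).trans hn⟩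

theorem isBoundedMeasurable_cutoff_coe (f : C(A.spectrum, ℝ≥0)) (n : ℕ) :
    IsBoundedMeasurable ((cutoff f n).indicator fun s => (s : ℝ)) :=
  .indicator_of_bound measurable_subtype_coe ((isCutoff_cutoff f).measurableSet n) (C := n)
    fun s hs => by
      rw [Real.norm_of_nonneg (A.pos_of_mem_spectrum s.2).le]
      exact hs.1

theorem isBoundedMeasurable_cutoff_sqrt (f : C(A.spectrum, ℝ≥0)) (n : ℕ) :
    IsBoundedMeasurable ((cutoff f n).indicator fun s => √(s : ℝ)) :=
  .indicator_of_bound measurable_sqrt_coe ((isCutoff_cutoff f).measurableSet n) (C := √n)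
    fun s hs => by
      rw [Real.norm_of_nonneg (by positivity)]
      exact Real.sqrt_le_sqrt hs.1

theorem isBoundedMeasurable_cutoff_damping (f : C(A.spectrum, ℝ≥0)) (n : ℕ) :
    IsBoundedMeasurable ((cutoff f n).indicator fun s => (f s : ℝ)) :=
  .indicator_of_bound (measurable_damping f) ((isCutoff_cutoff f).measurableSet n) (C := n)
    fun s hs => by
      rw [Real.norm_of_nonneg (NNReal.coe_nonneg _)]
      exact hs.2

variable (E : SpectralMeasure A.spectrum H) (f : C(A.spectrum, ℝ≥0))

/-- The cutoff depends on `f` although the square root does not, so that `A`, `A^{1/2}` and `f(A)`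
are all described by one exhausting sequence. -/
theorem mem_graph_sqrtOp_iff (u w : H) : (u, w) ∈ (sqrtOp E).graph ↔
    ∀ n, E.bounded ((cutoff f n).indicator fun s => √(s : ℝ)) u = E.toFun (cutoff f n) w := by
  rw [sqrtOp, SpectralMeasure.graph_integral]
  exact (isCutoff_cutoff f).mem_integralGraph_iff measurable_sqrt_coe
    (isBoundedMeasurable_cutoff_sqrt f) u w

theorem mem_graph_damping_iff (u w : H) : (u, w) ∈ (damping E f).graph ↔
    ∀ n, E.bounded ((cutoff f n).indicator fun s => (f s : ℝ)) u = E.toFun (cutoff f n) w := by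
  rw [damping, SpectralMeasure.graph_integral]
  exact (isCutoff_cutoff f).mem_integralGraph_iff (measurable_damping f)
    (isBoundedMeasurable_cutoff_damping f) u w

theorem mem_graph_op_iff {E : SpectralMeasure A.spectrum H} (hE : A.IsSpectralMeasure E)
    (u w : H) : (u, w) ∈ A.op.graph ↔
    ∀ n, E.bounded ((cutoff f n).indicator fun s => (s : ℝ)) u = E.toFun (cutoff f n) w := by
  rw [hE, SpectralMeasure.graph_integral]
  exact (isCutoff_cutoff f).mem_integralGraph_iff measurable_subtype_coe
    (isBoundedMeasurable_cutoff_coe f) u w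

theorem H1.sqrt_apply (u : H1 E) (n : ℕ) :
    E.bounded ((cutoff f n).indicator fun s => √(s : ℝ)) (H1.incl E u) =
      E.toFun (cutoff f n) (H1.sqrt E u) :=
  (mem_graph_sqrtOp_iff E f _ _).1 ((LinearPMap.mem_graph_iff _).2 ⟨u, rfl, rfl⟩) n

theorem H1.sqrt_surjective : Function.Surjective (H1.sqrt E) := by
  intro y
  -- Any `f` would do here: it only supplies a cutoff. The preimage of `y` is `∫ s^{-1/2} dE y`, a
  -- bounded integral.
  let f : C(A.spectrum, ℝ≥0) := 0
  have h : (E.bounded (fun s => (√(s : ℝ))⁻¹) y, y) ∈ (sqrtOp E).graph := by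
    rw [mem_graph_sqrtOp_iff E f]
    intro n
    rw [SpectralMeasure.bounded_bounded (isBoundedMeasurable_cutoff_sqrt f n)
      isBoundedMeasurable_inv_sqrt,
      ← SpectralMeasure.bounded_indicator_one ((isCutoff_cutoff f).measurableSet n)]
    congr 2
    ext s
    have hs : √(s : ℝ) ≠ 0 := (Real.sqrt_pos.2 (A.pos_of_mem_spectrum s.2)).ne'
    by_cases hx : s ∈ cutoff f n <;> simp [hx, hs]
  obtain ⟨u, -, hu⟩ := (LinearPMap.mem_graph_iff _).1 h
  exact ⟨u, hu⟩

/-- The isometric isomorphism `A^{1/2} : H¹ ≃ H`. -/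
noncomputable def H1.equiv : H1 E ≃ₗᵢ[ℂ] H :=
  LinearIsometryEquiv.ofSurjective ⟨H1.sqrt E, fun _ => rfl⟩ (H1.sqrt_surjective E)

instance : CompleteSpace (H1 E) :=
  (completeSpace_congr (e := (H1.equiv E).toEquiv) (H1.equiv E).isometry.isUniformEmbedding).2
    inferInstance

/-- The truncations of the wave operator. -/
noncomputable def truncatedGenerator : TruncatedGenerator (PhaseSpace E) :=
  truncatedWave (H1.equiv E) (fun n => E.toFun (cutoff f n))
    (fun n => E.bounded ((cutoff f n).indicator fun s => √(s : ℝ)))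
    (fun n => E.bounded ((cutoff f n).indicator fun s => (f s : ℝ)))
    (fun n x => E.norm_toFun_le _ x) (fun x => (isCutoff_cutoff f).tendsto_toFun E x)
    (fun m n x => by
      rw [SpectralMeasure.toFun_bounded ((isCutoff_cutoff f).measurableSet m)
        (isBoundedMeasurable_cutoff_sqrt f n),
        SpectralMeasure.bounded_toFun ((isCutoff_cutoff f).measurableSet m)
        (isBoundedMeasurable_cutoff_sqrt f n)])
    (fun m n x => by
      rw [SpectralMeasure.toFun_bounded ((isCutoff_cutoff f).measurableSet m)
        (isBoundedMeasurable_cutoff_damping f n),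
        SpectralMeasure.bounded_toFun ((isCutoff_cutoff f).measurableSet m)
        (isBoundedMeasurable_cutoff_damping f n)])
    (fun m n x hmn => by
      rw [SpectralMeasure.bounded_toFun ((isCutoff_cutoff f).measurableSet m)
        (isBoundedMeasurable_cutoff_sqrt f n), Set.indicator_indicator,
        Set.inter_eq_left.2 ((isCutoff_cutoff f).mono hmn)])
    (fun m n x hmn => by
      rw [SpectralMeasure.bounded_toFun ((isCutoff_cutoff f).measurableSet m)
        (isBoundedMeasurable_cutoff_damping f n), Set.indicator_indicator,
        Set.inter_eq_left.2 ((isCutoff_cutoff f).mono hmn)])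
    (fun n x y => SpectralMeasure.inner_bounded_left (isBoundedMeasurable_cutoff_sqrt f n) y x)
    (fun n x => by
      rw [SpectralMeasure.inner_bounded_self (isBoundedMeasurable_cutoff_damping f n),
        Complex.ofReal_re]
      exact integral_nonneg fun s => Set.indicator_nonneg (fun s _ => (f s).2) s)

variable {E}

/-- The first component of `G n x = P n y`: for all `n` together it puts `v` in the domain of
`A^{1/2}` with the same image as `a`, and `A^{1/2}` is injective. -/
theorem incl_eq_iff (a : H1 E) (v : H) :
    (∀ n, E.bounded ((cutoff f n).indicator fun s => √(s : ℝ)) v =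
      E.toFun (cutoff f n) (H1.sqrt E a)) ↔ H1.incl E a = v := by
  constructor
  · intro h
    have h1 := (mem_graph_sqrtOp_iff E f v (H1.sqrt E a)).2 h
    obtain ⟨b, hb1, hb2⟩ := (LinearPMap.mem_graph_iff _).1 h1
    have : b = a := H1.sqrt_injective E hb2
    rw [← this]
    exact hb1
  · rintro rfl n
    exact H1.sqrt_apply E f a n

/-- Gives a truncated meaning to `A u = A^{1/2} A^{1/2} u` for every `u` in `H¹`, without requiring
`u` in the domain of `A`. -/
theorem bounded_sqrt_sqrt (u : H1 E) (n : ℕ) :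
    E.bounded ((cutoff f n).indicator fun s => √(s : ℝ)) (H1.sqrt E u) =
      E.bounded ((cutoff f n).indicator fun s => (s : ℝ)) (H1.incl E u) := by
  have hm := (isCutoff_cutoff f).measurableSet n
  have hb := isBoundedMeasurable_cutoff_sqrt f n
  have h1 : E.bounded ((cutoff f n).indicator fun s => √(s : ℝ)) (H1.sqrt E u) =
      E.bounded ((cutoff f n).indicator fun s => √(s : ℝ))
        (E.toFun (cutoff f n) (H1.sqrt E u)) := by
    rw [SpectralMeasure.bounded_toFun hm hb, Set.indicator_indicator, Set.inter_self]
  rw [h1, ← H1.sqrt_apply, SpectralMeasure.bounded_bounded hb hb]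
  congr 2
  ext s
  by_cases hx : s ∈ cutoff f n
  · simp [hx, Real.mul_self_sqrt (A.pos_of_mem_spectrum s.2).le]
  · simp [hx]

/-- Given the truncated identities, pair them with `w`, move the operators onto `w`, where they
become `E(ω n) A w` and `E(ω n) f(A) w`, and let `n → ∞`. Conversely `E(ω n) x` lies in both domains
for every `x`, and testing on it recovers the `n`-th identity. -/
theorem dualSumEq_iff (hE : A.IsSpectralMeasure E) (u : H1 E) (v k : H) :
    (∀ n, -(E.bounded ((cutoff f n).indicator fun s => √(s : ℝ)) (H1.sqrt E u) +
      E.bounded ((cutoff f n).indicator fun s => (f s : ℝ)) v) = E.toFun (cutoff f n) k) ↔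
    DualSumEq E f (H1.incl E u) v (-k) := by
  have hω := isCutoff_cutoff f
  have hs := isBoundedMeasurable_cutoff_coe f
  have hf := isBoundedMeasurable_cutoff_damping f
  simp_rw [bounded_sqrt_sqrt]
  constructor
  · intro h w hw hw'
    have hA := (mem_graph_op_iff f hE w _).1 ((LinearPMap.mem_graph_iff _).2 ⟨⟨w, hw⟩, rfl, rfl⟩)
    have hF := (mem_graph_damping_iff E f w _).1
      ((LinearPMap.mem_graph_iff _).2 ⟨⟨w, hw'⟩, rfl, rfl⟩)
    refine tendsto_nhds_unique ((hω.tendsto_inner E _ _).add (hω.tendsto_inner E _ _))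
      ((hω.tendsto_inner E w (-k)).congr fun n => ?_)
    rw [SpectralMeasure.inner_toFun_right, map_neg, ← h n, neg_neg, inner_add_left,
      SpectralMeasure.inner_bounded_left (hs n), SpectralMeasure.inner_bounded_left (hf n)]
    exact congrArg₂ _ (congrArg _ (hA n)) (congrArg _ (hF n))
  · intro h n
    refine ext_inner_right ℂ fun x => ?_
    have hA : (E.toFun (cutoff f n) x, E.bounded ((cutoff f n).indicator fun s => (s : ℝ)) x) ∈
        A.op.graph := by
      refine (mem_graph_op_iff f hE _ _).2 fun m => ?_
      rw [SpectralMeasure.bounded_toFun (hω.measurableSet n) (hs m),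
        SpectralMeasure.toFun_bounded (hω.measurableSet m) (hs n), Set.indicator_indicator,
        Set.indicator_indicator, Set.inter_comm]
    have hF : (E.toFun (cutoff f n) x, E.bounded ((cutoff f n).indicator fun s => (f s : ℝ)) x) ∈
        (damping E f).graph := by
      refine (mem_graph_damping_iff E f _ _).2 fun m => ?_
      rw [SpectralMeasure.bounded_toFun (hω.measurableSet n) (hf m),
        SpectralMeasure.toFun_bounded (hω.measurableSet m) (hf n), Set.indicator_indicator,
        Set.indicator_indicator, Set.inter_comm]
    obtain ⟨⟨a, ha⟩, ha1, ha2⟩ := (LinearPMap.mem_graph_iff _).1 hA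
    obtain ⟨⟨b, hb⟩, hb1, hb2⟩ := (LinearPMap.mem_graph_iff _).1 hF
    dsimp only at ha1 ha2 hb1 hb2
    subst ha1
    subst hb1
    have h1 := h _ ha hb
    rw [ha2, hb2, SpectralMeasure.inner_toFun_right, map_neg, inner_neg_left] at h1
    rw [inner_neg_left, inner_add_left, SpectralMeasure.inner_bounded_left (hs n),
      SpectralMeasure.inner_bounded_left (hf n), h1, neg_neg]

theorem graph_generator_eq (hE : A.IsSpectralMeasure E) :
    (truncatedGenerator E f).semigroup.generator.graph = waveGraph E f := by
  rw [ContractionSemigroup.graph_generator]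
  ext p
  rw [TruncatedGenerator.mem_generatorGraph_iff]
  have h1 : p ∈ waveGraph E f ↔ H1.incl E p.2.fst = p.1.snd ∧
    DualSumEq E f (H1.incl E p.1.fst) p.1.snd (-p.2.snd) := Iff.rfl
  rw [h1, ← incl_eq_iff f, ← dualSumEq_iff f hE, ← forall_and]
  refine forall_congr' fun n => ?_
  have h2 : ((truncatedGenerator E f).G n p.1).fst = (H1.equiv E).symm
      (E.bounded ((cutoff f n).indicator fun s => √(s : ℝ)) p.1.snd) := rfl
  have h3 : ((truncatedGenerator E f).P n p.2).fst = (H1.equiv E).symm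
      (E.toFun (cutoff f n) (H1.sqrt E p.2.fst)) := rfl
  constructor
  · intro h
    refine ⟨?_, congrArg WithLp.snd h⟩
    have h4 := congrArg WithLp.fst h
    rw [h2, h3] at h4
    exact (H1.equiv E).symm.injective h4
  · rintro ⟨h4, h5⟩
    refine WithLp.prod_ext ?_ h5
    rw [h2, h3, h4]

end StrictlyPositiveOperator

/-! ### Construction of spectral measures -/

section Construction

variable {H : Type*} [NormedAddCommGroup H] [InnerProductSpace ℂ H]

theorem ContinuousLinearMap.ext_of_inner_self {S T : H →L[ℂ] H}
    (h : ∀ u, inner ℂ u (S u) = inner ℂ u (T u)) : S = T := by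
  have h1 := (ext_inner_map (S : H →ₗ[ℂ] H) (T : H →ₗ[ℂ] H)).1 fun u => by
    rw [← inner_conj_symm, ← inner_conj_symm (T.toLinearMap u)]
    exact congrArg _ (h u)
  ext u
  exact DFunLike.congr_fun h1 u

variable [CompleteSpace H]

/-- A spectral measure from a family of operators `Q ω` and a family of scalar measures `ν u` such
that `⟨Q ω u, Q ω' u⟩ = ν u (ω ∩ ω')` and `⟨Q ω u, u⟩ = ν u ω`. -/
noncomputable def SpectralMeasure.ofMeasures {Ω : Type*} [MeasurableSpace Ω]
    (Q : Set Ω → H →L[ℂ] H)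
    (ν : H → Measure Ω) [∀ u, IsFiniteMeasure (ν u)] (hQ : ∀ ω, ¬ MeasurableSet ω → Q ω = 0)
    (h₁ : ∀ ω, MeasurableSet ω → ∀ u, inner ℂ u (Q ω u) = ((ν u).real ω : ℂ))
    (h₂ : ∀ ω ω', MeasurableSet ω → MeasurableSet ω' → ∀ u,
      inner ℂ (Q ω u) (Q ω' u) = ((ν u).real (ω ∩ ω') : ℂ))
    (h₃ : ∀ u, (ν u).real Set.univ = ‖u‖ ^ 2) : SpectralMeasure Ω H :=
  have hsymm : ∀ ω, MeasurableSet ω → IsSelfAdjoint (Q ω) := fun ω hω => by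
    rw [ContinuousLinearMap.isSelfAdjoint_iff_isSymmetric,
      LinearMap.isSymmetric_iff_inner_map_self_real]
    intro u
    have h4 : inner ℂ (Q ω u) u = ((ν u).real ω : ℂ) := by
      rw [← inner_conj_symm, h₁ ω hω]
      exact Complex.conj_ofReal _
    change (starRingEnd ℂ) (inner ℂ (Q ω u) u) = inner ℂ (Q ω u) u
    rw [h4]
    exact Complex.conj_ofReal _
  have hinner : ∀ ω, MeasurableSet ω → ∀ u v, inner ℂ (Q ω u) v = inner ℂ u (Q ω v) :=
    fun ω hω => (ContinuousLinearMap.isSelfAdjoint_iff_isSymmetric.1 (hsymm ω hω))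
  have hinter : ∀ ω₁ ω₂, MeasurableSet ω₁ → MeasurableSet ω₂ → Q (ω₁ ∩ ω₂) = Q ω₁ * Q ω₂ :=
    fun ω₁ ω₂ hω₁ hω₂ => ContinuousLinearMap.ext_of_inner_self fun u => by
      rw [h₁ _ (hω₁.inter hω₂), ← h₂ ω₁ ω₂ hω₁ hω₂, hinner ω₁ hω₁]
      rfl
  { toFun := Q
    not_measurable := hQ
    isStarProjection := fun ω hω => ⟨by
      rw [IsIdempotentElem, ← hinter ω ω hω hω, Set.inter_self], hsymm ω hω⟩
    empty := ContinuousLinearMap.ext_of_inner_self fun u => by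
      rw [h₁ _ .empty]
      simp
    univ := ContinuousLinearMap.ext_of_inner_self fun u => by
      rw [h₁ _ .univ, h₃, one_apply_eq_self, inner_self_eq_norm_sq_to_K]
      simp
    inter := hinter
    union := fun ω₁ ω₂ hω₁ hω₂ hd => ContinuousLinearMap.ext_of_inner_self fun u => by
      rw [h₁ _ (hω₁.union hω₂), add_apply, inner_add_right, h₁ _ hω₁, h₁ _ hω₂,
        measureReal_union hd hω₂, Complex.ofReal_add]
    hasSum_inner := fun u v ω hω hd => by
      have h4 : ∀ w, HasSum (fun n => inner ℂ (Q (ω n) w) w) (inner ℂ (Q (⋃ n, ω n) w) w) := by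
        intro w
        simp_rw [hinner _ (hω _), hinner _ (MeasurableSet.iUnion hω), h₁ _ (hω _),
          h₁ _ (MeasurableSet.iUnion hω)]
        rw [Complex.hasSum_ofReal]
        simp only [Measure.real]
        rw [measure_iUnion hd hω]
        rw [ENNReal.tsum_toReal_eq fun n => measure_ne_top _ _]
        refine ENNReal.hasSum_toReal ?_
        rw [← measure_iUnion hd hω]
        exact measure_ne_top _ _
      simp_rw [← hinner _ (hω _), ← hinner _ (MeasurableSet.iUnion hω)]
      -- Polarization reduces weak countable additivity to the diagonal, where it is that of the
      -- measures `ν w`.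
      have h5 : ∀ S : H →L[ℂ] H, _ := fun S => inner_map_polarization' (S : H →ₗ[ℂ] H) v u
      simp only [ContinuousLinearMap.coe_coe] at h5
      simp_rw [h5]
      exact ((((h4 _).sub (h4 _)).sub ((h4 _).mul_left _)).add ((h4 _).mul_left _)).div_const 4 }

/-! ### Scalar spectral measures of a bounded selfadjoint operator -/

variable {T : H →L[ℂ] H} (hT : IsSelfAdjoint T)

theorem inner_cfcHom_left (φ : C(spectrum ℝ T, ℝ)) (u v : H) :
    inner ℂ (cfcHom hT φ u) v = inner ℂ u (cfcHom hT φ v) := by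
  have h : IsSelfAdjoint (cfcHom hT φ) := cfcHom_predicate hT φ
  exact ContinuousLinearMap.isSelfAdjoint_iff_isSymmetric.1 h u v

theorem inner_cfcHom_cfcHom (φ ψ : C(spectrum ℝ T, ℝ)) (u : H) :
    inner ℂ (cfcHom hT φ u) (cfcHom hT ψ u) = inner ℂ u (cfcHom hT (φ * ψ) u) := by
  rw [inner_cfcHom_left, map_mul]
  rfl

/-- The positive functional `φ ↦ ⟨φ(T)u, u⟩`. -/
noncomputable def spectralFunctional (u : H) :
    CompactlySupportedContinuousMap (spectrum ℝ T) ℝ →ₚ[ℝ] ℝ :=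
  PositiveLinearMap.mk₀
    { toFun := fun φ => (inner ℂ u (cfcHom hT φ.toContinuousMap u)).re
      map_add' := fun φ ψ => by
        have h : (φ + ψ).toContinuousMap = φ.toContinuousMap + ψ.toContinuousMap := rfl
        rw [h, map_add, add_apply, inner_add_right, Complex.add_re]
      map_smul' := fun c φ => by
        have h : (c • φ).toContinuousMap = c • φ.toContinuousMap := rfl
        rw [h, map_smul, smul_apply, ← Complex.coe_smul, inner_smul_right]
        simp }
    fun φ hφ => by
      -- With `φ = ψ²`, positivity reads `⟨φ(T)u, u⟩ = ‖ψ(T)u‖² ≥ 0`.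
      let ψ : C(spectrum ℝ T, ℝ) := ⟨fun x => √(φ x), by fun_prop⟩
      have h : φ.toContinuousMap = ψ * ψ := by
        ext x
        exact (Real.mul_self_sqrt (hφ x)).symm
      change 0 ≤ (inner ℂ u (cfcHom hT φ.toContinuousMap u)).re
      rw [h, ← inner_cfcHom_cfcHom]
      exact inner_self_nonneg (𝕜 := ℂ)

/-- The measure representing `φ ↦ ⟨φ(T)u, u⟩`. -/
noncomputable def scalarSpectralMeasure (u : H) : Measure (spectrum ℝ T) :=
  RealRMK.rieszMeasure (spectralFunctional hT u)

instance (u : H) : IsFiniteMeasure (scalarSpectralMeasure hT u) :=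
  inferInstanceAs (IsFiniteMeasure (RealRMK.rieszMeasure (spectralFunctional hT u)))

theorem inner_cfcHom_self (φ : C(spectrum ℝ T, ℝ)) (u : H) :
    inner ℂ u (cfcHom hT φ u) = ((∫ x, φ x ∂scalarSpectralMeasure hT u : ℝ) : ℂ) := by
  have h1 := RealRMK.integral_rieszMeasure (spectralFunctional hT u)
    (CompactlySupportedContinuousMap.continuousMapEquiv φ)
  have h2 : ∫ x, φ x ∂scalarSpectralMeasure hT u = (inner ℂ u (cfcHom hT φ u)).re := h1
  rw [h2]
  have h3 : (starRingEnd ℂ) (inner ℂ u (cfcHom hT φ u)) = inner ℂ u (cfcHom hT φ u) := by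
    rw [inner_conj_symm, inner_cfcHom_left]
  exact (Complex.conj_eq_iff_re.1 h3).symm

/-- The inclusion of the continuous functions in `L²`. -/
noncomputable abbrev continuousToL2 (u : H) :
    C(spectrum ℝ T, ℝ) →L[ℝ] Lp ℝ 2 (scalarSpectralMeasure hT u) :=
  ContinuousMap.toLp 2 (scalarSpectralMeasure hT u) ℝ

theorem denseRange_continuousToL2 (u : H) : DenseRange (continuousToL2 hT u) :=
  ContinuousMap.toLp_denseRange ℝ (scalarSpectralMeasure hT u) ℝ (by simp)

/-- Shows that `φ ↦ φ(T)u` is isometric for the `L²(μ_u)` norm, so that it extends from continuous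
functions to indicators. -/
theorem inner_cfcHom_eq_inner_L2 (φ ψ : C(spectrum ℝ T, ℝ)) (u : H) :
    inner ℂ (cfcHom hT φ u) (cfcHom hT ψ u) =
      ((inner ℝ (continuousToL2 hT u φ) (continuousToL2 hT u ψ) : ℝ) : ℂ) := by
  rw [inner_cfcHom_cfcHom, inner_cfcHom_self, ContinuousMap.inner_toLp]
  congr 2
  ext x
  simp [mul_comm]

theorem norm_cfcHom_apply (φ : C(spectrum ℝ T, ℝ)) (u : H) :
    ‖cfcHom hT φ u‖ = ‖continuousToL2 hT u φ‖ := by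
  have h := inner_cfcHom_eq_inner_L2 hT φ φ u
  rw [inner_self_eq_norm_sq_to_K, real_inner_self_eq_norm_sq] at h
  have h' : ‖cfcHom hT φ u‖ ^ 2 = ‖continuousToL2 hT u φ‖ ^ 2 :=
    Complex.ofReal_injective (by simpa using h)
  exact (pow_left_inj₀ (norm_nonneg _) (norm_nonneg _) two_ne_zero).1 h'

/-- The evaluation `φ ↦ φ(T)u` on continuous functions. -/
noncomputable def cfcEval (u : H) : C(spectrum ℝ T, ℝ) →ₗ[ℝ] H where
  toFun φ := cfcHom hT φ u
  map_add' φ ψ := by rw [map_add]; rfl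
  map_smul' c φ := by rw [map_smul]; rfl

/-- The isometry `L²(μ_u) → H` extending `φ ↦ φ(T)u`. -/
noncomputable def spectralIsometry (u : H) : Lp ℝ 2 (scalarSpectralMeasure hT u) →L[ℝ] H :=
  (cfcEval hT u).extendOfNorm (continuousToL2 hT u).toLinearMap

theorem spectralIsometry_continuousToL2 (φ : C(spectrum ℝ T, ℝ)) (u : H) :
    spectralIsometry hT u (continuousToL2 hT u φ) = cfcHom hT φ u := by
  have h1 : ∀ φ, ‖cfcEval hT u φ‖ ≤ 1 * ‖(continuousToL2 hT u).toLinearMap φ‖ := fun φ => by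
    rw [one_mul]
    exact (norm_cfcHom_apply hT φ u).le
  have h2 : DenseRange (continuousToL2 hT u).toLinearMap := denseRange_continuousToL2 hT u
  have h3 := LinearMap.extendOfNorm_eq h2 ⟨1, h1⟩ φ
  exact h3

theorem inner_spectralIsometry (u : H) (g h : Lp ℝ 2 (scalarSpectralMeasure hT u)) :
    inner ℂ (spectralIsometry hT u g) (spectralIsometry hT u h) = ((inner ℝ g h : ℝ) : ℂ) := by
  refine (denseRange_continuousToL2 hT u).induction_on₂ (p := fun g h =>
    inner ℂ (spectralIsometry hT u g) (spectralIsometry hT u h) = ((inner ℝ g h : ℝ) : ℂ))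
    ?_ (fun φ ψ => ?_) g h
  · exact isClosed_eq (by fun_prop) (by fun_prop)
  · rw [spectralIsometry_continuousToL2, spectralIsometry_continuousToL2,
      inner_cfcHom_eq_inner_L2]

theorem norm_spectralIsometry (u : H) (g : Lp ℝ 2 (scalarSpectralMeasure hT u)) :
    ‖spectralIsometry hT u g‖ = ‖g‖ := by
  have h := inner_spectralIsometry hT u g g
  rw [inner_self_eq_norm_sq_to_K, real_inner_self_eq_norm_sq] at h
  have h' : ‖spectralIsometry hT u g‖ ^ 2 = ‖g‖ ^ 2 :=
    Complex.ofReal_injective (by simpa using h)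
  exact (pow_left_inj₀ (norm_nonneg _) (norm_nonneg _) two_ne_zero).1 h'

/-- The vector `1_ω(T) u`. -/
noncomputable def spectralVector {ω : Set (spectrum ℝ T)} (hω : MeasurableSet ω) (u : H) : H :=
  spectralIsometry hT u
    (indicatorConstLp 2 hω (measure_ne_top (scalarSpectralMeasure hT u) ω) (1 : ℝ))

theorem inner_spectralVector {ω ω' : Set (spectrum ℝ T)} (hω : MeasurableSet ω)
    (hω' : MeasurableSet ω') (u : H) :
    inner ℂ (spectralVector hT hω u) (spectralVector hT hω' u) =
      ((scalarSpectralMeasure hT u).real (ω ∩ ω') : ℂ) := by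
  rw [spectralVector, spectralVector, inner_spectralIsometry, L2.inner_indicatorConstLp_one,
    setIntegral_congr_ae hω (g := ω'.indicator fun _ => (1 : ℝ))
      (indicatorConstLp_coeFn.mono fun x hx _ => hx),
    setIntegral_indicator hω']
  simp

theorem spectralVector_univ (u : H) : spectralVector hT MeasurableSet.univ u = u := by
  have h1 : indicatorConstLp 2 MeasurableSet.univ
      (measure_ne_top (scalarSpectralMeasure hT u) Set.univ) (1 : ℝ) = continuousToL2 hT u 1 := by
    refine Lp.ext ?_
    filter_upwards [indicatorConstLp_coeFn (p := 2) (hs := MeasurableSet.univ)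
      (hμs := measure_ne_top (scalarSpectralMeasure hT u) Set.univ) (c := (1 : ℝ)),
      ContinuousMap.coeFn_toLp (p := 2) (𝕜 := ℝ) (scalarSpectralMeasure hT u) (1 : C(_, ℝ))]
      with x h1 h2
    rw [h1, h2]
    simp
  rw [spectralVector, h1, spectralIsometry_continuousToL2, map_one]
  rfl

/-- Each `u` has its own space `L²(μ_u)`, so linearity of `u ↦ 1_ω(T)u` is not automatic.
Approximating the indicator in `L²(ν)` gives one continuous `φ` that works for all `u` with `μ_u ≤
ν` at once, and `φ(T)` is linear. -/
theorem exists_norm_spectralVector_sub_le {ω : Set (spectrum ℝ T)} (hω : MeasurableSet ω)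
    (ν : Measure (spectrum ℝ T)) [IsFiniteMeasure ν] {ε : ℝ} (hε : 0 < ε) :
    ∃ φ : C(spectrum ℝ T, ℝ), ∀ u, scalarSpectralMeasure hT u ≤ ν →
      ‖spectralVector hT hω u - cfcHom hT φ u‖ ≤ ε := by
  obtain ⟨g, hg, -⟩ := (memLp_indicator_const (μ := ν) 2 hω (1 : ℝ)
    (Or.inr (measure_ne_top _ _))).exists_boundedContinuous_eLpNorm_sub_le (by simp)
    (ε := ENNReal.ofReal ε) (by simpa using hε)
  refine ⟨g.toContinuousMap, fun u hu => ?_⟩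
  rw [spectralVector, ← spectralIsometry_continuousToL2, ← map_sub, norm_spectralIsometry,
    Lp.norm_def]
  refine ENNReal.toReal_le_of_le_ofReal hε.le (le_trans (le_of_eq ?_)
    ((eLpNorm_mono_measure _ hu).trans hg))
  refine eLpNorm_congr_ae ?_
  filter_upwards [Lp.coeFn_sub (indicatorConstLp 2 hω
      (measure_ne_top (scalarSpectralMeasure hT u) ω) (1 : ℝ))
      (continuousToL2 hT u g.toContinuousMap),
    indicatorConstLp_coeFn (p := 2) (hs := hω)
      (hμs := measure_ne_top (scalarSpectralMeasure hT u) ω) (c := (1 : ℝ)),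
    ContinuousMap.coeFn_toLp (p := 2) (𝕜 := ℝ) (scalarSpectralMeasure hT u) g.toContinuousMap]
    with x h1 h2 h3
  rw [h1, Pi.sub_apply, Pi.sub_apply, h2, h3]
  rfl

theorem spectralVector_add {ω : Set (spectrum ℝ T)} (hω : MeasurableSet ω) (u v : H) :
    spectralVector hT hω (u + v) = spectralVector hT hω u + spectralVector hT hω v := by
  refine eq_of_forall_dist_le fun ε hε => ?_
  -- The sum of the three measures dominates each of them, so a single `φ` serves all three vectors.
  obtain ⟨φ, hφ⟩ := exists_norm_spectralVector_sub_le hT hω (scalarSpectralMeasure hT u +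
    scalarSpectralMeasure hT v + scalarSpectralMeasure hT (u + v)) (ε := ε / 3) (by positivity)
  have h1 := hφ u ((Measure.le_add_right le_rfl).trans (Measure.le_add_right le_rfl))
  have h2 := hφ v ((Measure.le_add_left le_rfl).trans (Measure.le_add_right le_rfl))
  have h3 := hφ (u + v) (Measure.le_add_left le_rfl)
  rw [dist_eq_norm]
  have h4 : spectralVector hT hω (u + v) - (spectralVector hT hω u + spectralVector hT hω v) =
      (spectralVector hT hω (u + v) - cfcHom hT φ (u + v)) -
      (spectralVector hT hω u - cfcHom hT φ u) - (spectralVector hT hω v - cfcHom hT φ v) := by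
    rw [map_add]
    abel
  rw [h4]
  linarith [norm_sub_le ((spectralVector hT hω (u + v) - cfcHom hT φ (u + v)) -
      (spectralVector hT hω u - cfcHom hT φ u)) (spectralVector hT hω v - cfcHom hT φ v),
    norm_sub_le (spectralVector hT hω (u + v) - cfcHom hT φ (u + v))
      (spectralVector hT hω u - cfcHom hT φ u)]

theorem spectralVector_smul {ω : Set (spectrum ℝ T)} (hω : MeasurableSet ω) (c : ℂ) (u : H) :
    spectralVector hT hω (c • u) = c • spectralVector hT hω u := by
  refine eq_of_forall_dist_le fun ε hε => ?_
  have hc : 0 < 1 + ‖c‖ := by positivity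
  obtain ⟨φ, hφ⟩ := exists_norm_spectralVector_sub_le hT hω (scalarSpectralMeasure hT u +
    scalarSpectralMeasure hT (c • u)) (ε := ε / (1 + ‖c‖)) (by positivity)
  have h1 := hφ u (Measure.le_add_right le_rfl)
  have h2 := hφ (c • u) (Measure.le_add_left le_rfl)
  rw [dist_eq_norm]
  have h4 : spectralVector hT hω (c • u) - c • spectralVector hT hω u =
      (spectralVector hT hω (c • u) - cfcHom hT φ (c • u)) -
      c • (spectralVector hT hω u - cfcHom hT φ u) := by
    rw [map_smul, smul_sub]
    abel
  rw [h4]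
  refine (norm_sub_le _ _).trans ?_
  rw [norm_smul]
  calc _ ≤ ε / (1 + ‖c‖) + ‖c‖ * (ε / (1 + ‖c‖)) := by gcongr
    _ = ε := by field_simp

theorem norm_spectralVector_le {ω : Set (spectrum ℝ T)} (hω : MeasurableSet ω) (u : H) :
    ‖spectralVector hT hω u‖ ≤ ‖u‖ := by
  have h1 := inner_spectralVector hT hω hω u
  have h2 := inner_spectralVector hT MeasurableSet.univ MeasurableSet.univ u
  rw [spectralVector_univ, inner_self_eq_norm_sq_to_K] at h2
  rw [inner_self_eq_norm_sq_to_K] at h1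
  have h1' : ‖spectralVector hT hω u‖ ^ 2 = (scalarSpectralMeasure hT u).real (ω ∩ ω) :=
    Complex.ofReal_injective (by simpa using h1)
  have h2' : ‖u‖ ^ 2 = (scalarSpectralMeasure hT u).real (Set.univ ∩ Set.univ) :=
    Complex.ofReal_injective (by simpa using h2)
  refine le_of_sq_le_sq ?_ (norm_nonneg _)
  rw [h1', h2']
  exact measureReal_mono (by simp)

open Classical in
/-- The spectral projection `1_ω(T)`. -/
noncomputable def spectralProjection (ω : Set (spectrum ℝ T)) : H →L[ℂ] H :=
  if hω : MeasurableSet ω then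
    LinearMap.mkContinuous
      { toFun := spectralVector hT hω
        map_add' := spectralVector_add hT hω
        map_smul' := spectralVector_smul hT hω } 1
      fun u => by rw [one_mul]; exact norm_spectralVector_le hT hω u
  else 0

theorem spectralProjection_apply {ω : Set (spectrum ℝ T)} (hω : MeasurableSet ω) (u : H) :
    spectralProjection hT ω u = spectralVector hT hω u := by
  rw [spectralProjection, dif_pos hω]
  rfl

/-- With `e = 1_{0}(T)u`, the vector `T e` is orthogonal to every `φ(T)u`, since `x φ(x)` vanishes
on `{0}`. By density it is orthogonal to the range of the isometry, which contains `e`. -/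
theorem inner_spectralVector_zero (u : H)
    (hω : MeasurableSet {x : spectrum ℝ T | (x : ℝ) = 0}) :
    inner ℂ (spectralVector hT hω u) (T (spectralVector hT hω u)) = 0 := by
  set e := spectralVector hT hω u with he
  have hsymm := ContinuousLinearMap.isSelfAdjoint_iff_isSymmetric.1 hT
  have h1 : ∀ g, inner ℂ (T e) (spectralIsometry hT u g) = 0 := by
    intro g
    refine (denseRange_continuousToL2 hT u).induction_on (p := fun g =>
      inner ℂ (T e) (spectralIsometry hT u g) = 0) g ?_ fun φ => ?_
    · exact isClosed_eq (by fun_prop) (by fun_prop)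
    · have h2 : T (cfcHom hT φ u) =
          cfcHom hT ((ContinuousMap.id ℝ).restrict (spectrum ℝ T) * φ) u := by
        rw [map_mul, cfcHom_id]
        rfl
      have h3 : inner ℂ (T e) (cfcHom hT φ u) = inner ℂ e (T (cfcHom hT φ u)) := hsymm _ _
      rw [spectralIsometry_continuousToL2, h3, h2, ← spectralIsometry_continuousToL2, he,
        spectralVector, inner_spectralIsometry, L2.inner_indicatorConstLp_one]
      rw [setIntegral_congr_ae hω (g := fun _ => (0 : ℝ))]
      · simp
      · filter_upwards [ContinuousMap.coeFn_toLp (p := 2) (𝕜 := ℝ) (scalarSpectralMeasure hT u)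
          ((ContinuousMap.id ℝ).restrict (spectrum ℝ T) * φ)] with x hx hx0
        rw [hx]
        have : (x : ℝ) = 0 := hx0
        simp [this]
  have h4 : inner ℂ (T e) e = inner ℂ e (T e) := hsymm _ _
  rw [← h4]
  exact h1 _

end Construction

/-! ### The spectral theorem for strictly positive operators -/

namespace StrictlyPositiveOperator

variable {H : Type*} [NormedAddCommGroup H] [InnerProductSpace ℂ H] [CompleteSpace H]
  (A : StrictlyPositiveOperator H)

/-- The map `s ↦ s⁻¹` from `σ(A)` to `σ(A⁻¹)`. -/
noncomputable def invSpectrum (s : A.spectrum) : _root_.spectrum ℝ A.inverse :=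
  ⟨(s : ℝ)⁻¹, ((A.mem_spectrum_iff s).1 s.2).2⟩

theorem image_invSpectrum (ω : Set ℝ) :
    A.invSpectrum '' (Subtype.val ⁻¹' ω) =
      {t : _root_.spectrum ℝ A.inverse | (t : ℝ) ≠ 0 ∧ (t : ℝ)⁻¹ ∈ ω} := by
  ext t
  constructor
  · rintro ⟨s, hs, rfl⟩
    refine ⟨inv_ne_zero (A.pos_of_mem_spectrum s.2).ne', ?_⟩
    change ((s : ℝ)⁻¹)⁻¹ ∈ ω
    rw [inv_inv]
    exact hs
  · rintro ⟨h0, ht⟩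
    refine ⟨⟨(t : ℝ)⁻¹, (A.mem_spectrum_iff _).2 ⟨inv_ne_zero h0, ?_⟩⟩, ht, ?_⟩
    · rw [inv_inv]
      exact t.2
    · exact Subtype.ext (inv_inv _)

theorem range_invSpectrum :
    Set.range A.invSpectrum = {t : _root_.spectrum ℝ A.inverse | (t : ℝ) = 0}ᶜ := by
  have h := A.image_invSpectrum Set.univ
  rw [Set.preimage_univ, Set.image_univ] at h
  rw [h]
  ext t
  simp

theorem measurableEmbedding_invSpectrum : MeasurableEmbedding A.invSpectrum where
  injective s t h := Subtype.ext (inv_injective (congrArg Subtype.val h))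
  measurable := measurable_subtype_coe.inv.subtype_mk
  measurableSet_image' := by
    rintro _ ⟨ω, hω, rfl⟩
    rw [image_invSpectrum]
    exact (measurableSet_eq_fun measurable_subtype_coe measurable_const).compl.inter
      (measurable_subtype_coe.inv hω)

/-- For `u = A⁻¹ w`, the pairing is `⟨A u, u⟩` up to conjugation, which is at least `c ‖u‖²`. -/
theorem inner_inverse_eq_zero {w : H} (h : inner ℂ w (A.inverse w) = 0) : w = 0 := by
  obtain ⟨c, hc, hA⟩ := A.strictlyPositive
  obtain ⟨u, hu1, hu2⟩ := (LinearPMap.mem_graph_iff _).1 ((A.mem_graph_iff _ w).2 rfl)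
  have h1 := hA u
  dsimp only at hu1 hu2
  rw [hu2, hu1, ← inner_conj_symm, h] at h1
  simp only [map_zero, Complex.zero_re] at h1
  have h2 : ‖A.inverse w‖ = 0 := by
    by_contra h3
    have : 0 < ‖A.inverse w‖ := lt_of_le_of_ne (norm_nonneg _) (Ne.symm h3)
    nlinarith [mul_pos hc (pow_pos this 2)]
  exact A.inverse_injective (by rw [norm_eq_zero.1 h2, map_zero])

/-- The point `0` may lie in the spectrum of `A⁻¹` but is not of the form `s⁻¹`. It carries no mass,
because `1_{0}(A⁻¹)u = 0` by strict positivity. -/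
theorem ae_mem_range_invSpectrum (u : H) :
    ∀ᵐ t ∂scalarSpectralMeasure A.isSelfAdjoint_inverse u, t ∈ Set.range A.invSpectrum := by
  have hω : MeasurableSet {t : _root_.spectrum ℝ A.inverse | (t : ℝ) = 0} :=
    measurableSet_eq_fun measurable_subtype_coe measurable_const
  have h1 := A.inner_inverse_eq_zero (inner_spectralVector_zero A.isSelfAdjoint_inverse u hω)
  have h2 := inner_spectralVector A.isSelfAdjoint_inverse hω hω u
  rw [h1, inner_zero_left, Set.inter_self] at h2
  have h3 : (scalarSpectralMeasure A.isSelfAdjoint_inverse u).real {t | (t : ℝ) = 0} = 0 := by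
    exact_mod_cast h2.symm
  rw [range_invSpectrum, ae_iff]
  simpa [Measure.real, ENNReal.toReal_eq_zero_iff] using h3

/-- The scalar spectral measures of `A`. -/
noncomputable def scalarMeasure (u : H) : Measure A.spectrum :=
  (scalarSpectralMeasure A.isSelfAdjoint_inverse u).comap A.invSpectrum

theorem scalarMeasure_apply (u : H) (ω : Set A.spectrum) :
    A.scalarMeasure u ω =
      scalarSpectralMeasure A.isSelfAdjoint_inverse u (A.invSpectrum '' ω) :=
  A.measurableEmbedding_invSpectrum.comap_apply _ _

instance (u : H) : IsFiniteMeasure (A.scalarMeasure u) :=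
  ⟨by rw [scalarMeasure_apply]; exact measure_lt_top _ _⟩

open Classical in
/-- The spectral measure of `A`. -/
noncomputable def spectralMeasure : SpectralMeasure A.spectrum H :=
  SpectralMeasure.ofMeasures
    (fun ω => if MeasurableSet ω then
      spectralProjection A.isSelfAdjoint_inverse (A.invSpectrum '' ω) else 0)
    A.scalarMeasure (fun ω hω => if_neg hω)
    (fun ω hω u => by
      have h := inner_spectralVector A.isSelfAdjoint_inverse MeasurableSet.univ
        (A.measurableEmbedding_invSpectrum.measurableSet_image.2 hω) u
      rw [spectralVector_univ, Set.univ_inter] at h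
      rw [if_pos hω, spectralProjection_apply _
        (A.measurableEmbedding_invSpectrum.measurableSet_image.2 hω), h, Measure.real, Measure.real,
        scalarMeasure_apply])
    (fun ω ω' hω hω' u => by
      rw [if_pos hω, if_pos hω', spectralProjection_apply _
        (A.measurableEmbedding_invSpectrum.measurableSet_image.2 hω), spectralProjection_apply _
        (A.measurableEmbedding_invSpectrum.measurableSet_image.2 hω'), inner_spectralVector,
        Measure.real, Measure.real, scalarMeasure_apply,
        Set.image_inter A.measurableEmbedding_invSpectrum.injective])
    (fun u => by
      have h := inner_spectralVector A.isSelfAdjoint_inverse MeasurableSet.univ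
        MeasurableSet.univ u
      rw [spectralVector_univ, Set.univ_inter, inner_self_eq_norm_sq_to_K] at h
      have h' : ‖u‖ ^ 2 = (scalarSpectralMeasure A.isSelfAdjoint_inverse u).real Set.univ :=
        Complex.ofReal_injective (by simpa using h)
      rw [h', Measure.real, Measure.real, scalarMeasure_apply, Set.image_univ]
      congr 1
      -- Absence of mass at `0` is what makes the projection of the whole space the identity.
      refine measure_congr ?_
      filter_upwards [A.ae_mem_range_invSpectrum u] with t ht
      exact propext ⟨fun _ => trivial, fun _ => ht⟩)

theorem variation_spectralMeasure (u : H) :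
    (A.spectralMeasure.complexMeasure u u).variation = A.scalarMeasure u := by
  ext ω hω
  have hm := A.measurableEmbedding_invSpectrum.measurableSet_image.2 hω
  have h1 : A.spectralMeasure.toFun ω u = spectralVector A.isSelfAdjoint_inverse hm u := by
    rw [← spectralProjection_apply]
    exact DFunLike.congr_fun (if_pos hω) u
  have h2 := inner_spectralVector A.isSelfAdjoint_inverse hm hm u
  rw [inner_self_eq_norm_sq_to_K, Set.inter_self] at h2
  have h3 : ‖spectralVector A.isSelfAdjoint_inverse hm u‖ ^ 2 =
      (scalarSpectralMeasure A.isSelfAdjoint_inverse u).real (A.invSpectrum '' ω) :=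
    Complex.ofReal_injective (by simpa using h2)
  rw [A.spectralMeasure.variation_self_apply u hω, h1, h3, scalarMeasure_apply,
    ofReal_measureReal]

theorem isBoundedMeasurable_inv : IsBoundedMeasurable fun s : A.spectrum => (s : ℝ)⁻¹ := by
  obtain ⟨C, hC0, hC⟩ := A.exists_inv_le
  refine ⟨measurable_subtype_coe.inv, C, fun s => ?_⟩
  rw [Real.norm_of_nonneg (inv_nonneg.2 (A.pos_of_mem_spectrum s.2).le)]
  exact hC s s.2

/-- On the diagonal this is the change of variables `t = s⁻¹` in `⟨T u, u⟩ = ∫ t dμ_u(t)`, lossless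
since `μ_u` lives on the range of `s ↦ s⁻¹`. -/
theorem bounded_inv_spectralMeasure :
    A.spectralMeasure.bounded (fun s => (s : ℝ)⁻¹) = A.inverse := by
  refine ContinuousLinearMap.ext_of_inner_self fun u => ?_
  have h1 := inner_cfcHom_self A.isSelfAdjoint_inverse
    ((ContinuousMap.id ℝ).restrict (_root_.spectrum ℝ A.inverse)) u
  rw [cfcHom_id] at h1
  rw [SpectralMeasure.inner_bounded_self A.isBoundedMeasurable_inv, h1, variation_spectralMeasure]
  congr 1
  have h2 : (A.scalarMeasure u).map A.invSpectrum =
      scalarSpectralMeasure A.isSelfAdjoint_inverse u := by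
    rw [scalarMeasure, A.measurableEmbedding_invSpectrum.map_comap]
    exact Measure.restrict_eq_self_of_ae_mem (A.ae_mem_range_invSpectrum u)
  rw [← h2, A.measurableEmbedding_invSpectrum.integral_map]
  rfl

/-- Both graphs are compared through `A⁻¹ = ∫ s⁻¹ dE`: on each cutoff, `s` and `s⁻¹` are bounded and
multiply to the indicator. -/
theorem isSpectralMeasure_spectralMeasure : A.IsSpectralMeasure A.spectralMeasure := by
  -- With `f = 0` the cutoff is just `{s ≤ n}`.
  let f : C(A.spectrum, ℝ≥0) := 0
  have hω := isCutoff_cutoff f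
  have hs := isBoundedMeasurable_cutoff_coe f
  have hi := A.isBoundedMeasurable_inv
  have hne : ∀ s : A.spectrum, (s : ℝ) ≠ 0 := fun s => (A.pos_of_mem_spectrum s.2).ne'
  refine LinearPMap.eq_of_eq_graph ?_
  rw [SpectralMeasure.graph_integral]
  ext ⟨u, w⟩
  rw [A.mem_graph_iff, hω.mem_integralGraph_iff measurable_subtype_coe hs,
    ← bounded_inv_spectralMeasure]
  constructor
  · rintro rfl n
    rw [SpectralMeasure.bounded_bounded (hs n) hi,
      ← SpectralMeasure.bounded_indicator_one (hω.measurableSet n)]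
    congr 2
    ext s
    by_cases hx : s ∈ cutoff f n <;> simp [hx, hne s]
  · intro h
    refine hω.ext A.spectralMeasure fun n => ?_
    rw [SpectralMeasure.toFun_bounded (hω.measurableSet n) hi,
      ← SpectralMeasure.bounded_toFun (hω.measurableSet n) hi, ← h n,
      SpectralMeasure.bounded_bounded hi (hs n),
      ← SpectralMeasure.bounded_indicator_one (hω.measurableSet n)]
    congr 2
    ext s
    by_cases hx : s ∈ cutoff f n <;> simp [hx, hne s]

end StrictlyPositiveOperator

theorem mainTheorem8 {H : Type*} [NormedAddCommGroup H] [InnerProductSpace ℂ H] [CompleteSpace H]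
    (A : StrictlyPositiveOperator H) (f : C(A.spectrum, ℝ≥0)) :
    (∃ E : SpectralMeasure A.spectrum H, A.IsSpectralMeasure E) ∧
    ∀ E : SpectralMeasure A.spectrum H, A.IsSpectralMeasure E →
      ∃ S : ContractionSemigroup (StrictlyPositiveOperator.PhaseSpace E),
        S.generator.graph = StrictlyPositiveOperator.waveGraph E f :=
  ⟨⟨A.spectralMeasure, A.isSpectralMeasure_spectralMeasure⟩, fun E hE =>
    ⟨(StrictlyPositiveOperator.truncatedGenerator E f).semigroup,
      StrictlyPositiveOperator.graph_generator_eq f hE⟩⟩
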